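/- Let $N\ge 1$ and let $S_1,S_2\subset\mathbb{R}^{N+1}$ be smooth non-degenerate locally convex hypersurfaces, i.e. the Blaschke metric $h_i$ of $S_i$ is definite at every point. Let $\nu_i$ be the conormal map of $S_i$: $\nu_i$ vanishes on the tangent space and equals $1$ on the affine normal. For $p_1\in S_1$, $p_2\in S_2$ put $M=\frac{p_1+p_2}{2}$, $C=\frac{p_1-p_2}{2}$, let $Z$ be the intersection of the tangent spaces $T_{p_1}S_1$ and $T_{p_2}S_2$, and let $$F(p_1,p_2,X)=\bigl(\nu_2(C)\,\nu_1+\nu_1(C)\,\nu_2\bigr)(X-M),$$ so that $F(p_1,p_2,\cdot)=0$ is the equation of the mid-hyperplane, the hyperplane through $M$ and $Z$. A pair $(p_1,p_2)$ *generates* $X\in\mathbb{R}^{N+1}$ if the tangent spaces at $p_1,p_2$ are transversal, the mid-hyperplane is defined ($M\notin Z$), and $F=0$, $\partial F/\partial p_1=0$, $\partial F/\partial p_2=0$ at $(p_1,p_2,X)$. The envelope of mid-hyperplanes EMH is the set of all $X$ generated by some pair. A *contact conic* at $(p_1,p_2)$, where the tangent spaces are transversal, is a non-degenerate plane conic that makes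 contact of order $\ge 3$ (three-point contact, i.e. agreement of $2$-jets) with $S_i$ at $p_i$, $i=1,2$, in a direction $Y_i\in T_{p_i}S_i$ that is $h_i$-orthogonal to $Z$. A conic with a center is an ellipse or a hyperbola (both branches). A *normal form* of $(S_1,S_2)$ at $(p_1,p_2)$, with parameters $\epsilon=\pm1$ and $p\in\mathbb{R}$, $\epsilon p<0$, is an affine coordinate system $(x,\mathbf{y},z)\in\mathbb{R}\times\mathbb{R}^{N-1}\times\mathbb{R}$ with $p_1=(0,\mathbf 0,1)$, $p_2=(0,\mathbf 0,-1)$, in which $S_1$ and $S_2$ are, near $p_1$ and $p_2$, the graphs $z=f_i(x,\mathbf y)$ of smooth functions $$f_1=1+\epsilon p x-\tfrac12(p^2+\epsilon)x^2+\sum_{j,k}a_{jk}y_jy_k+O(3),$$ $$f_2=-1-\epsilon p x+\tfrac12(p^2+\epsilon)x^2+\sum_{j,k}b_{jk}y_jy_k+O(3),$$ where the symmetric matrices $(a_{jk})$ and $(b_{jk})$ are each positive or negative definite. Then: 1. The set of centers of contact conics, over all pairs $(p_1,p_2)\in S_1\times S_2$, is exactly the EMH. More precisely, a pair $(p_1,p_2)$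 generates $X$ if and only if there is a contact conic at $(p_1,p_2)$ with center $X$. 2. A pair $(p_1,p_2)$ generates $X$ if and only if there is a normal form at $(p_1,p_2)$ in which $X=(p,\mathbf 0,0)$. 3. In every normal form at $(p_1,p_2)$ in which $X=(p,\mathbf 0,0)$, every contact conic at $(p_1,p_2)$ with center $X$ is an ellipse if and only if $\epsilon=1$, and a hyperbola if and only if $\epsilon=-1$. -/

import Mathlib

open Filter Topology Asymptotics
open scoped ContDiff

noncomputable section

namespace EMHConics

/-- Affine space of dimension `N + 1`, where `N = n + 1 ≥ 1`. -/
abbrev Aff (n : ℕ) := Fin (n + 2) → ℝ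

/-- Parameter space of dimension `N = n + 1`. -/
abbrev Par (n : ℕ) := Fin (n + 1) → ℝ

variable {n : ℕ}

/-! ## Hypersurfaces -/

/-- A smooth local parametrization of the set `S`: a smooth immersion of an open set `dom` of the
parameter space that is a homeomorphism onto a relatively open part of `S`. -/
structure Patch (S : Set (Aff n)) where
  dom : Set (Par n)
  ψ : Par n → Aff n
  isOpen_dom : IsOpen dom
  smooth : ContDiffOn ℝ ∞ ψ dom
  immersion : ∀ u ∈ dom, Function.Injective (fderiv ℝ ψ u)
  embedding : IsEmbedding (dom.domRestrict ψ)
  image_open : ∃ V : Set (Aff n), IsOpen V ∧ ψ '' dom = S ∩ V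

/-- `S` is a smooth (embedded) hypersurface. -/
def IsSmoothHypersurface (S : Set (Aff n)) : Prop :=
  ∀ p ∈ S, ∃ P : Patch S, ∃ u ∈ P.dom, P.ψ u = p

/-- The direction of the tangent space at the point with parameter `u`. -/
def tangentDir (ψ : Par n → Aff n) (u : Par n) : Submodule ℝ (Aff n) :=
  LinearMap.range (fderiv ℝ ψ u).toLinearMap

/-! ## Blaschke metric and conormal

For a transversal field `ξ`, the induced volume is `θ(∂₁, …, ∂_N) = [∂₁ψ, …, ∂_Nψ, ξ]`.  The
conormal `ν` and the form `h` of the affine normal are determined by `ν = 0` on the tangent space,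
`h(X, Y) = ν(D_X Y)` and `θ = θ_h`.  Writing `L = [∂₁ψ, …, ∂_Nψ, D²ψ]`, this gives
`ν = |det L|^(-1/(N+2)) [∂₁ψ, …, ∂_Nψ, ·]` and `h = |det L|^(-1/(N+2)) L`, up to a common sign.
That these are the objects induced by the affine normal is proved in
`IsAffineNormal.blaschke_eq` below. -/

/-- `[∂₁ψ, …, ∂_Nψ, v]`. -/
def frameVol (ψ : Par n → Aff n) (u : Par n) (v : Aff n) : ℝ :=
  Matrix.det (Matrix.of
    (Fin.snoc (α := fun _ => Aff n) (fun i => fderiv ℝ ψ u (Pi.single i 1)) v))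

/-- `L(a, b) = [∂₁ψ, …, ∂_Nψ, D²ψ(a, b)]`. -/
def frameForm (ψ : Par n → Aff n) (u a b : Par n) : ℝ :=
  frameVol ψ u (fderiv ℝ (fderiv ℝ ψ) u a b)

/-- The factor `|det L|^(-1/(N+2))`, where `N + 2 = n + 3`. -/
def blaschkeFactor (ψ : Par n → Aff n) (u : Par n) : ℝ :=
  |Matrix.det (Matrix.of fun i j : Fin (n + 1) =>
    frameForm ψ u (Pi.single i 1) (Pi.single j 1))| ^ (-(1 : ℝ) / ((n : ℝ) + 3))

/-- The Blaschke metric in the parameters: `blaschkeMetric ψ u a b = h(dψ a, dψ b)`. -/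
def blaschkeMetric (ψ : Par n → Aff n) (u a b : Par n) : ℝ :=
  blaschkeFactor ψ u * frameForm ψ u a b

/-- The conormal map `ν`, evaluated at the vector `v`. -/
def conormal (ψ : Par n → Aff n) (u : Par n) (v : Aff n) : ℝ :=
  blaschkeFactor ψ u * frameVol ψ u v

/-- `ξ` is an affine normal field of `ψ` on `dom`, with induced connection `Γ` and induced form `h`
(all written in the parameters): the Gauss equation `D_X Y = ∇_X Y + h(X, Y) ξ`, the condition
`∇θ = 0` on the coordinate frame, and `θ = θ_h` up to sign. -/
structure IsAffineNormal (dom : Set (Par n)) (ψ ξ : Par n → Aff n)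
    (Γ : Par n → Par n → Par n → Par n) (h : Par n → Par n → Par n → ℝ) : Prop where
  smooth : ContDiffOn ℝ ∞ ξ dom
  transversal : ∀ u ∈ dom, ξ u ∉ tangentDir ψ u
  gauss : ∀ u ∈ dom, ∀ a b,
    fderiv ℝ (fderiv ℝ ψ) u a b = fderiv ℝ ψ u (Γ u a b) + h u a b • ξ u
  parallel : ∀ u ∈ dom, ∀ k : Fin (n + 1),
    fderiv ℝ (fun s => frameVol ψ s (ξ s)) u (Pi.single k 1) =
      ∑ i : Fin (n + 1), Matrix.det (Matrix.of (Fin.snoc (α := fun _ => Aff n)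
        (Function.update (fun l => fderiv ℝ ψ u (Pi.single l 1)) i
          (fderiv ℝ ψ u (Γ u (Pi.single k 1) (Pi.single i 1)))) (ξ u)))
  volume : ∀ u ∈ dom, |frameVol ψ u (ξ u)| =
    |Matrix.det (Matrix.of fun i j : Fin (n + 1) =>
      h u (Pi.single i 1) (Pi.single j 1))| ^ (1 / 2 : ℝ)

theorem snoc_eq_update (w : Fin (n + 1) → Aff n) (v : Aff n) :
    Fin.snoc (α := fun _ => Aff n) w v =
      Function.update (Fin.snoc (α := fun _ => Aff n) w 0) (Fin.last (n + 1)) v := by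
  rw [Fin.update_snoc_last]

theorem frameVol_add (ψ : Par n → Aff n) (u : Par n) (v w : Aff n) :
    frameVol ψ u (v + w) = frameVol ψ u v + frameVol ψ u w := by
  unfold frameVol
  rw [snoc_eq_update, snoc_eq_update _ v, snoc_eq_update _ w]
  exact Matrix.det_updateRow_add _ _ _ _

theorem frameVol_smul (ψ : Par n → Aff n) (u : Par n) (c : ℝ) (v : Aff n) :
    frameVol ψ u (c • v) = c * frameVol ψ u v := by
  unfold frameVol
  rw [snoc_eq_update, snoc_eq_update _ v]
  exact Matrix.det_updateRow_smul _ _ _ _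

theorem frameVol_tangent (ψ : Par n → Aff n) (u a : Par n) :
    frameVol ψ u (fderiv ℝ ψ u a) = 0 := by
  have hs : ∀ i : Fin (n + 1), frameVol ψ u (fderiv ℝ ψ u (Pi.single i 1)) = 0 := by
    intro i
    unfold frameVol
    refine Matrix.det_zero_of_row_eq (i := i.castSucc) (j := Fin.last (n + 1))
      (Fin.castSucc_lt_last i).ne ?_
    simp [Matrix.of_apply, funext_iff]
  have hl : IsLinearMap ℝ (frameVol ψ u) :=
    ⟨frameVol_add ψ u, fun c v => by rw [frameVol_smul, smul_eq_mul]⟩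
  have := LinearMap.pi_ext' (f := (hl.mk' _).comp (fderiv ℝ ψ u).toLinearMap) (g := 0)
    (fun i => LinearMap.ext_ring (by simpa using hs i))
  exact LinearMap.congr_fun this a

theorem IsAffineNormal.frameVol_ne_zero {dom : Set (Par n)} {ψ ξ : Par n → Aff n}
    {Γ : Par n → Par n → Par n → Par n} {h : Par n → Par n → Par n → ℝ}
    (H : IsAffineNormal dom ψ ξ Γ h) {u : Par n} (hu : u ∈ dom)
    (hi : Function.Injective (fderiv ℝ ψ u)) : frameVol ψ u (ξ u) ≠ 0 := by
  have hb : LinearIndependent ℝ (fun i : Fin (n + 1) => fderiv ℝ ψ u (Pi.single i 1)) := by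
    have := (Pi.basisFun ℝ (Fin (n + 1))).linearIndependent.map' (fderiv ℝ ψ u).toLinearMap
      (LinearMap.ker_eq_bot.2 hi)
    simpa [Function.comp_def] using this
  have hs : LinearIndependent ℝ (Fin.snoc (α := fun _ => Aff n)
      (fun i : Fin (n + 1) => fderiv ℝ ψ u (Pi.single i 1)) (ξ u)) := by
    refine linearIndependent_finSnoc.2 ⟨hb, fun hm => H.transversal u hu ?_⟩
    refine (Submodule.span_le.2 ?_) hm
    rintro _ ⟨i, rfl⟩
    exact ⟨_, rfl⟩
  have hu' : IsUnit (Matrix.of (Fin.snoc (α := fun _ => Aff n)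
      (fun i : Fin (n + 1) => fderiv ℝ ψ u (Pi.single i 1)) (ξ u))) :=
    Matrix.linearIndependent_rows_iff_isUnit.1 hs
  exact ((Matrix.isUnit_iff_isUnit_det _).1 hu').ne_zero

/-- The explicit Blaschke metric and conormal are, up to a common sign, those induced by the affine
normal field. -/
theorem IsAffineNormal.blaschke_eq {dom : Set (Par n)} {ψ ξ : Par n → Aff n}
    {Γ : Par n → Par n → Par n → Par n} {h : Par n → Par n → Par n → ℝ}
    (H : IsAffineNormal dom ψ ξ Γ h) {u : Par n} (hu : u ∈ dom)
    (hi : Function.Injective (fderiv ℝ ψ u)) :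
    ∃ s : ℝ, (s = 1 ∨ s = -1) ∧ conormal ψ u (ξ u) = s ∧
      (∀ a, conormal ψ u (fderiv ℝ ψ u a) = 0) ∧
      ∀ a b, blaschkeMetric ψ u a b = s * h u a b := by
  set c := frameVol ψ u (ξ u) with hc
  have hc0 : c ≠ 0 := H.frameVol_ne_zero hu hi
  have hL : ∀ a b, frameForm ψ u a b = c * h u a b := by
    intro a b
    rw [frameForm, H.gauss u hu, frameVol_add, frameVol_smul, frameVol_tangent]
    ring
  have hdet : Matrix.det (Matrix.of fun i j : Fin (n + 1) =>
      frameForm ψ u (Pi.single i 1) (Pi.single j 1)) = c ^ (n + 1) *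
      Matrix.det (Matrix.of fun i j : Fin (n + 1) =>
        h u (Pi.single i 1) (Pi.single j 1)) := by
    have : (Matrix.of fun i j : Fin (n + 1) => frameForm ψ u (Pi.single i 1) (Pi.single j 1)) =
        c • Matrix.of fun i j : Fin (n + 1) => h u (Pi.single i 1) (Pi.single j 1) := by
      ext i j
      simp [hL]
    rw [this, Matrix.det_smul]
    simp
  have hv := H.volume u hu
  rw [← hc, ← Real.sqrt_eq_rpow] at hv
  have hv2 : |Matrix.det (Matrix.of fun i j : Fin (n + 1) =>
      h u (Pi.single i 1) (Pi.single j 1))| = |c| ^ 2 := by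
    rw [hv, Real.sq_sqrt (abs_nonneg _)]
  have hφ : blaschkeFactor ψ u = |c|⁻¹ := by
    have hpos : 0 ≤ |c| := abs_nonneg c
    rw [blaschkeFactor, hdet, abs_mul, abs_pow, hv2, ← pow_add, ← Real.rpow_natCast,
      ← Real.rpow_mul hpos, ← Real.rpow_neg_one]
    congr 1
    have : (n : ℝ) + 3 ≠ 0 := by positivity
    push_cast
    field_simp
    ring
  refine ⟨|c|⁻¹ * c, ?_, ?_, ?_, ?_⟩
  · rcases lt_or_gt_of_ne hc0 with hneg | hpos
    · right
      rw [abs_of_neg hneg]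
      field_simp
    · left
      rw [abs_of_pos hpos]
      field_simp
  · rw [conormal, hφ]
  · intro a
    rw [conormal, frameVol_tangent, mul_zero]
  · intro a b
    rw [blaschkeMetric, hφ, hL, mul_assoc]

/-- The hypersurface is non-degenerate and locally convex: its Blaschke metric is everywhere
(positive or negative) definite. -/
def IsLocallyConvex (S : Set (Aff n)) : Prop :=
  ∀ P : Patch S, ∀ u ∈ P.dom,
    (∀ a : Par n, a ≠ 0 → 0 < blaschkeMetric P.ψ u a a) ∨
      (∀ a : Par n, a ≠ 0 → blaschkeMetric P.ψ u a a < 0)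

/-! ## The envelope of mid-hyperplanes -/

/-- The mid-point `M`. -/
def midPt (p₁ p₂ : Aff n) : Aff n := (1 / 2 : ℝ) • (p₁ + p₂)

/-- The mid-chord `C`. -/
def midChord (p₁ p₂ : Aff n) : Aff n := (1 / 2 : ℝ) • (p₁ - p₂)

/-- The tangent spaces at the two points are transversal. -/
def Transversal (ψ₁ ψ₂ : Par n → Aff n) (u₁ u₂ : Par n) : Prop :=
  tangentDir ψ₁ u₁ ⊔ tangentDir ψ₂ u₂ = ⊤

/-- The point `X` lies on the intersection `Z` of the two affine tangent spaces. -/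
def OnZ (ψ₁ ψ₂ : Par n → Aff n) (u₁ u₂ : Par n) (X : Aff n) : Prop :=
  X - ψ₁ u₁ ∈ tangentDir ψ₁ u₁ ∧ X - ψ₂ u₂ ∈ tangentDir ψ₂ u₂

/-- `F(p₁, p₂, X) = (ν₂(C) ν₁ + ν₁(C) ν₂)(X - M)`. -/
def midF (ψ₁ ψ₂ : Par n → Aff n) (u₁ u₂ : Par n) (X : Aff n) : ℝ :=
  let C := midChord (ψ₁ u₁) (ψ₂ u₂)
  let M := midPt (ψ₁ u₁) (ψ₂ u₂)
  conormal ψ₂ u₂ C * conormal ψ₁ u₁ (X - M) + conormal ψ₁ u₁ C * conormal ψ₂ u₂ (X - M)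

/-- `X` is a point of the envelope of mid-hyperplanes generated by the pair `(p₁, p₂)`: the tangent
spaces are transversal, the mid-hyperplane is defined (`M` is not on `Z`), and
`F = F_{p₁} = F_{p₂} = 0`. -/
def GeneratesEMH (S₁ S₂ : Set (Aff n)) (p₁ p₂ X : Aff n) : Prop :=
  ∃ P₁ : Patch S₁, ∃ P₂ : Patch S₂, ∃ u₁ ∈ P₁.dom, ∃ u₂ ∈ P₂.dom,
    P₁.ψ u₁ = p₁ ∧ P₂.ψ u₂ = p₂ ∧
    Transversal P₁.ψ P₂.ψ u₁ u₂ ∧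
    ¬ OnZ P₁.ψ P₂.ψ u₁ u₂ (midPt p₁ p₂) ∧
    midF P₁.ψ P₂.ψ u₁ u₂ X = 0 ∧
    fderiv ℝ (fun s => midF P₁.ψ P₂.ψ s u₂ X) u₁ = 0 ∧
    fderiv ℝ (fun s => midF P₁.ψ P₂.ψ u₁ s X) u₂ = 0

/-- The envelope of mid-hyperplanes. -/
def EMH (S₁ S₂ : Set (Aff n)) : Set (Aff n) :=
  {X | ∃ p₁ ∈ S₁, ∃ p₂ ∈ S₂, GeneratesEMH S₁ S₂ p₁ p₂ X}

/-! ## Conics -/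

/-- `K` is an ellipse, in some plane, with center `X`. -/
def IsEllipse (K : Set (Aff n)) (X : Aff n) : Prop :=
  ∃ v w : Aff n, LinearIndependent ℝ ![v, w] ∧
    K = {q | ∃ a b : ℝ, a ^ 2 + b ^ 2 = 1 ∧ q = X + a • v + b • w}

/-- `K` is a hyperbola (both branches), in some plane, with center `X`. -/
def IsHyperbola (K : Set (Aff n)) (X : Aff n) : Prop :=
  ∃ v w : Aff n, LinearIndependent ℝ ![v, w] ∧
    K = {q | ∃ a b : ℝ, a ^ 2 - b ^ 2 = 1 ∧ q = X + a • v + b • w}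

/-- `K` is a (non-degenerate) conic with center `X`; a parabola has no center. -/
def IsConic (K : Set (Aff n)) (X : Aff n) : Prop := IsEllipse K X ∨ IsHyperbola K X

/-- `K` makes contact of order `≥ k` with the hypersurface at `ψ u`, in the direction `dψ a`:
a regular local parametrization of `K` and a smooth curve on the hypersurface agree at the point
together with their derivatives of order `< k` (`k`-point contact). -/
def MakesContact (k : ℕ) (K : Set (Aff n)) (ψ : Par n → Aff n) (u a : Par n) : Prop :=
  a ≠ 0 ∧ ∃ γ : ℝ → Aff n, ∃ c : ℝ → Par n,
    ContDiffAt ℝ ∞ γ 0 ∧ (∀ᶠ t in 𝓝 0, γ t ∈ K) ∧ deriv γ 0 = fderiv ℝ ψ u a ∧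
    ContDiffAt ℝ ∞ c 0 ∧ c 0 = u ∧
    ∀ j < k, iteratedDeriv j γ 0 = iteratedDeriv j (fun t => ψ (c t)) 0

/-- The tangent vector `dψ a` is orthogonal, in the Blaschke metric, to the subspace `Z` of the
tangent space. -/
def OrthogonalTo (ψ : Par n → Aff n) (u a : Par n) (Z : Submodule ℝ (Aff n)) : Prop :=
  ∀ b : Par n, fderiv ℝ ψ u b ∈ Z → blaschkeMetric ψ u a b = 0

/-- `K` makes contact of order `≥ 3` with `Sᵢ` at `pᵢ`, for `i = 1, 2`, in directions that are
`hᵢ`-orthogonal to the intersection of the (transversal) tangent spaces. -/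
def IsContactConic (S₁ S₂ : Set (Aff n)) (p₁ p₂ : Aff n) (K : Set (Aff n)) : Prop :=
  ∃ P₁ : Patch S₁, ∃ P₂ : Patch S₂, ∃ u₁ ∈ P₁.dom, ∃ u₂ ∈ P₂.dom, ∃ a₁ a₂ : Par n,
    P₁.ψ u₁ = p₁ ∧ P₂.ψ u₂ = p₂ ∧
    Transversal P₁.ψ P₂.ψ u₁ u₂ ∧
    MakesContact 3 K P₁.ψ u₁ a₁ ∧ MakesContact 3 K P₂.ψ u₂ a₂ ∧
    OrthogonalTo P₁.ψ u₁ a₁ (tangentDir P₁.ψ u₁ ⊓ tangentDir P₂.ψ u₂) ∧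
    OrthogonalTo P₂.ψ u₂ a₂ (tangentDir P₁.ψ u₁ ⊓ tangentDir P₂.ψ u₂)

/-- The set of centers of the contact conics. -/
def contactConicCenters (S₁ S₂ : Set (Aff n)) : Set (Aff n) :=
  {X | ∃ p₁ ∈ S₁, ∃ p₂ ∈ S₂, ∃ K, IsConic K X ∧ IsContactConic S₁ S₂ p₁ p₂ K}

/-! ## The local normal form -/

/-- Coordinates `(x, y, z)` with `x, z ∈ ℝ` and `y ∈ ℝ^(N-1)`. -/
abbrev Coord (n : ℕ) := ℝ × (Fin n → ℝ) × ℝ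

/-- Near `p`, and in the affine coordinates `Φ`, the hypersurface `S` is the graph `z = f(x, y)` of
a smooth function on a neighbourhood of the origin. -/
def IsLocalGraph (S : Set (Aff n)) (p : Aff n) (Φ : Aff n ≃ᵃ[ℝ] Coord n)
    (f : ℝ × (Fin n → ℝ) → ℝ) : Prop :=
  ∃ W : Set (Aff n), IsOpen W ∧ p ∈ W ∧
    ∃ O : Set (ℝ × (Fin n → ℝ)), IsOpen O ∧ 0 ∈ O ∧ ContDiffOn ℝ ∞ f O ∧
      Φ '' (S ∩ W) = {q | (q.1, q.2.1) ∈ O ∧ q.2.2 = f (q.1, q.2.1)}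

/-- A symmetric matrix that is positive or negative definite. -/
def IsDefinite (A : Matrix (Fin n) (Fin n) ℝ) : Prop := A.PosDef ∨ (-A).PosDef

/-- In the affine coordinates `Φ` one has `p₁ = (0, 0, 1)`, `p₂ = (0, 0, -1)`, and `S₁`, `S₂` are
near these points the graphs of
`f₁ = 1 + ε p x - (p² + ε) x² / 2 + ∑ Aᵢⱼ yᵢ yⱼ + O(3)` and
`f₂ = -1 - ε p x + (p² + ε) x² / 2 + ∑ Bᵢⱼ yᵢ yⱼ + O(3)`
with `ε = ± 1`, `ε p < 0` and definite `A`, `B`. -/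
def IsNormalForm (S₁ S₂ : Set (Aff n)) (p₁ p₂ : Aff n) (Φ : Aff n ≃ᵃ[ℝ] Coord n)
    (ε p : ℝ) : Prop :=
  (ε = 1 ∨ ε = -1) ∧ ε * p < 0 ∧ Φ p₁ = (0, 0, 1) ∧ Φ p₂ = (0, 0, -1) ∧
  ∃ f₁ f₂ : ℝ × (Fin n → ℝ) → ℝ, ∃ A B : Matrix (Fin n) (Fin n) ℝ,
    IsLocalGraph S₁ p₁ Φ f₁ ∧ IsLocalGraph S₂ p₂ Φ f₂ ∧ IsDefinite A ∧ IsDefinite B ∧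
    (fun q => f₁ q - (1 + ε * p * q.1 - (1 / 2) * (p ^ 2 + ε) * q.1 ^ 2 +
      ∑ i, ∑ j, A i j * q.2 i * q.2 j)) =O[𝓝 0] (fun q => ‖q‖ ^ 3) ∧
    (fun q => f₂ q - (-1 - ε * p * q.1 + (1 / 2) * (p ^ 2 + ε) * q.1 ^ 2 +
      ∑ i, ∑ j, B i j * q.2 i * q.2 j)) =O[𝓝 0] (fun q => ‖q‖ ^ 3)

end EMHConics

end

noncomputable section

namespace EMHConics

variable {n : ℕ}

/-! ## Second order jets -/

section Jets

/-! Write `V = X - M`. The equations of the envelope, contact conics and normal forms are all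
equivalent to one condition, a configuration of ratio `lam` (`IsConfiguration`): the vectors `V -
lam C` and `V + lam C` are tangent at `p₁` and `p₂`, are `hᵢ`-orthogonal to `Z`, and have square
lengths `lam (1 - lam) ν₁(C)` and `-lam (1 - lam) ν₂(C)`. Here `lam` is neither `0` nor `1`, and
neither tangent space contains `C`.

Envelope. `F = 0` says `ν₁(V) = lam ν₁(C)` and `ν₂(V) = -lam ν₂(C)` for a common `lam`, which gives
the two tangent vectors. To differentiate `F` in `p₁`, write it as `ν₁` of a vector field corrected
by a tangent field so as to vanish at `p₁`; the derivative of `ν₁` then drops out and only `h₁`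
remains (`fderiv_midF`). `F_{p₁} = 0` becomes: the `h₁`-dual of the tangent vector is a prescribed
multiple of `ν₂`. Since this vector spans a complement of `Z` in the tangent space, that amounts to
its orthogonality to `Z` and its length (`orthogonalTo_and_length_iff`).

Conics. In the plane through `X` spanned by `V` and `C`, the conic `z² - lam x² = 1 - lam` passes
through both points, where `(x, z) = (-1, ±1)`, with exactly these tangents and normal accelerations
(`makesContact_of_isAdapted`). Conversely, for a contact conic with quadratic form `Q`, `V` and `C`
are conjugate and `lam = -Q(V) / Q(C)` (`conic_curvature`). The conic is an ellipse for `lam < 0`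
and a hyperbola for `lam > 0`.

Normal forms. Use coordinates with `C = (0, 0, 1)`, `V = (p, 0, 0)` and `Z` the `y`-space. With `lam
= -ε p²`, the tangent vectors give the slopes `±ε p`, the lengths give the `x²` coefficients, and
orthogonality to `Z` removes the mixed terms (`HasGraphJet.exists_isAdapted`,
`IsAdapted.exists_hasGraphJet`). The ratio is unique, so its sign identifies the type of the conic
with `ε`. -/

theorem two_le_infty : (2 : WithTop ℕ∞) ≤ ∞ :=
  WithTop.coe_le_coe.2 (le_top : (2 : ℕ∞) ≤ ⊤)

variable {E F : Type*} [NormedAddCommGroup E] [NormedSpace ℝ E] [NormedAddCommGroup F]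
  [NormedSpace ℝ F]

/-- Integration of an estimate of the derivative. -/
theorem isBigO_pow_succ_of_fderiv {G : E → F} {u : E} {k : ℕ}
    (hd : ∀ᶠ s in 𝓝 u, DifferentiableAt ℝ G s)
    (h : fderiv ℝ G =O[𝓝 u] fun s => ‖s - u‖ ^ k) (h0 : G u = 0) :
    G =O[𝓝 u] fun s => ‖s - u‖ ^ (k + 1) := by
  obtain ⟨c, hc⟩ := h.bound
  obtain ⟨r, hr, hb⟩ := Metric.eventually_nhds_iff_ball.1 (hd.and hc)
  refine IsBigO.of_bound c ?_
  filter_upwards [Metric.ball_mem_nhds u hr] with s hs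
  have hsub : Metric.closedBall u ‖s - u‖ ⊆ Metric.ball u r :=
    Metric.closedBall_subset_ball (by simpa [dist_eq_norm] using hs)
  have hc0 : ∀ x ∈ Metric.closedBall u ‖s - u‖, ‖fderiv ℝ G x‖ ≤ |c| * ‖s - u‖ ^ k := by
    intro x hx
    have h1 := (hb x (hsub hx)).2
    rw [Metric.mem_closedBall, dist_eq_norm] at hx
    simp only [norm_pow, norm_norm] at h1
    calc ‖fderiv ℝ G x‖ ≤ c * ‖x - u‖ ^ k := h1
      _ ≤ |c| * ‖x - u‖ ^ k := by gcongr; exact le_abs_self c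
      _ ≤ |c| * ‖s - u‖ ^ k := by gcongr
  have hm := (convex_closedBall u ‖s - u‖).norm_image_sub_le_of_norm_fderiv_le
    (fun x hx => (hb x (hsub hx)).1) hc0 (Metric.mem_closedBall_self (norm_nonneg _))
    (show s ∈ Metric.closedBall u ‖s - u‖ by simp [dist_eq_norm])
  rw [h0, sub_zero] at hm
  have hs' := (hb s hs).2
  rcases eq_or_ne s u with rfl | hne
  · simp [h0]
  · have hpos : 0 < ‖s - u‖ := norm_pos_iff.2 (sub_ne_zero.2 hne)
    -- The constant of the bound has no known sign; a negative one would bound a norm by a negative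
    -- number.
    by_cases hcn : 0 ≤ c
    · rw [abs_of_nonneg hcn] at hm
      simpa [pow_succ, mul_assoc] using hm
    · exfalso
      have : c * ‖s - u‖ ^ k < 0 := mul_neg_of_neg_of_pos (not_le.1 hcn) (by positivity)
      simp only [norm_pow, norm_norm] at hs'
      linarith [norm_nonneg (fderiv ℝ G s)]

/-- Taylor's formula of order two. -/
theorem taylor_two {G : E → F} {u : E} (hG : ContDiffAt ℝ ∞ G u) :
    (fun s => G s - G u - fderiv ℝ G u (s - u) -
      (1 / 2 : ℝ) • fderiv ℝ (fderiv ℝ G) u (s - u) (s - u)) =O[𝓝 u]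
      fun s => ‖s - u‖ ^ 3 := by
  have hG1 : ContDiffAt ℝ ∞ (fderiv ℝ G) u := hG.fderiv_right (by simp)
  have hG2 : ContDiffAt ℝ ∞ (fderiv ℝ (fderiv ℝ G)) u := hG1.fderiv_right (by simp)
  have hsymm : IsSymmSndFDerivAt ℝ G u := hG.isSymmSndFDerivAt (by simpa using two_le_infty)
  have hd : ∀ᶠ s in 𝓝 u, DifferentiableAt ℝ G s :=
    ((hG.of_le (m := 1) (by simp)).eventually (by simp)).mono
      fun s hs => hs.differentiableAt (by simp)
  have hd1 : ∀ᶠ s in 𝓝 u, DifferentiableAt ℝ (fderiv ℝ G) s :=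
    ((hG1.of_le (m := 1) (by simp)).eventually (by simp)).mono
      fun s hs => hs.differentiableAt (by simp)
  set A := fderiv ℝ G u
  set B := fderiv ℝ (fderiv ℝ G) u
  -- The remainder comes from integrating twice: the second derivative varies to first order, so the
  -- first derivative has a second-order remainder.
  have hK : (fun s => fderiv ℝ G s - A - B (s - u)) =O[𝓝 u] fun s => ‖s - u‖ ^ 2 := by
    have hder : ∀ s, DifferentiableAt ℝ (fderiv ℝ G) s →
        HasFDerivAt (fun s => fderiv ℝ G s - A - B (s - u)) (fderiv ℝ (fderiv ℝ G) s - B) s := by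
      intro s hs
      exact (hs.hasFDerivAt.sub_const A).sub (B.hasFDerivAt.comp s ((hasFDerivAt_id s).sub_const u))
    refine isBigO_pow_succ_of_fderiv (k := 1) (hd1.mono fun s hs => (hder s hs).differentiableAt)
      ?_ (by simp [A])
    have : (fun s => fderiv ℝ (fderiv ℝ G) s - B) =O[𝓝 u] fun s => ‖s - u‖ ^ 1 := by
      simpa using ((hG2.differentiableAt (by simp)).isBigO_sub).norm_right
    refine this.congr' ?_ EventuallyEq.rfl
    filter_upwards [hd1] with s hs using (hder s hs).fderiv.symm
  have hder : ∀ s, DifferentiableAt ℝ G s →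
      HasFDerivAt (fun s => G s - G u - A (s - u) - (1 / 2 : ℝ) • B (s - u) (s - u))
        (fderiv ℝ G s - A - B (s - u)) s := by
    intro s hs
    have hid := (hasFDerivAt_id (𝕜 := ℝ) s).sub_const u
    have hB : HasFDerivAt (fun s => B (s - u)) B s := B.hasFDerivAt.comp s hid
    have h1 := ((hs.hasFDerivAt.sub_const (G u)).sub (A.hasFDerivAt.comp s hid)).sub
      ((hB.clm_apply hid).const_smul (1 / 2 : ℝ))
    refine h1.congr_fderiv ?_
    ext a
    -- Symmetry of the second derivative merges the two halves of the derivative of `½ B(s - u, s -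
    -- u)`.
    have := hsymm (s - u) a
    simp only [id, sub_apply, smul_apply,
      add_apply, ContinuousLinearMap.comp_apply, ContinuousLinearMap.flip_apply,
      ContinuousLinearMap.id_apply]
    rw [show B a (s - u) = B (s - u) a from this.symm, ← two_smul ℝ, smul_smul]
    norm_num
  refine isBigO_pow_succ_of_fderiv (k := 2) (hd.mono fun s hs => (hder s hs).differentiableAt)
    ?_ (by simp)
  refine hK.congr' ?_ EventuallyEq.rfl
  filter_upwards [hd] with s hs using (hder s hs).fderiv.symm

/-- A polynomial `L + Q` of degree two that is of third order vanishes. -/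
theorem eq_zero_of_isBigO_cube {L Q : E → ℝ} {u : E} (hL : ∀ (t : ℝ) h, L (t • h) = t * L h)
    (hQ : ∀ (t : ℝ) h, Q (t • h) = t ^ 2 * Q h)
    (hO : (fun s => L (s - u) + Q (s - u)) =O[𝓝 u] fun s => ‖s - u‖ ^ 3) (h : E) :
    L h = 0 ∧ Q h = 0 := by
  have hlim : Tendsto (fun t : ℝ => u + t • h) (𝓝 0) (𝓝 u) := by
    have : Continuous fun t : ℝ => u + t • h := by fun_prop
    simpa using this.tendsto 0
  have h1 : (fun t : ℝ => t * L h + t ^ 2 * Q h) =O[𝓝 0] fun t : ℝ => t ^ 3 := by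
    have := hO.comp_tendsto hlim
    simp only [Function.comp_def, add_sub_cancel_left, hL, hQ, norm_smul] at this
    refine this.trans (IsBigO.of_bound (‖h‖ ^ 3) (Eventually.of_forall fun t => ?_))
    simp [mul_pow, mul_comm]
  have hlo : ∀ {m k : ℕ}, m < k → (fun t : ℝ => t ^ k) =o[𝓝 0] fun t : ℝ => t ^ m :=
    fun hmk => isLittleO_pow_pow hmk
  have hconst : ∀ {c : ℝ} {m : ℕ}, ((fun t : ℝ => t ^ m * c) =o[𝓝 0] fun t : ℝ => t ^ m) →
      c = 0 := by
    intro c m hc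
    by_contra hne
    -- The contradiction needs a function that is frequently nonzero, hence the punctured
    -- neighbourhood.
    have h2 : (fun t : ℝ => t ^ m) =o[𝓝[≠] 0] fun t : ℝ => t ^ m := by
      have := (hc.mono (nhdsWithin_le_nhds (s := {0}ᶜ))).const_mul_left c⁻¹
      refine this.congr_left fun t => ?_
      field_simp
    have h3 := isLittleO_irrefl' (l := 𝓝[≠] (0 : ℝ)) (f' := fun t : ℝ => t ^ m) ?_
    · exact h3 h2
    · refine (eventually_mem_nhdsWithin.mono fun t ht => ?_).frequently
      exact norm_ne_zero_iff.2 (pow_ne_zero _ ht)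
  have hL0 : L h = 0 := by
    refine hconst (m := 1) ?_
    have h2 : (fun t : ℝ => t ^ 2 * Q h) =o[𝓝 0] fun t : ℝ => t ^ 1 := by
      simpa [mul_comm] using (hlo (m := 1) (k := 2) (by norm_num)).const_mul_left (Q h)
    refine ((h1.trans_isLittleO (hlo (m := 1) (by norm_num))).sub h2).congr_left fun t => ?_
    ring
  refine ⟨hL0, hconst (m := 2) ?_⟩
  refine (h1.trans_isLittleO (hlo (m := 2) (by norm_num))).congr_left fun t => ?_
  rw [hL0]
  ring

/-- The 2-jet of `ℓ - b` along `ψ`, for a linear form `ℓ` and a quadratic form `b`. -/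
theorem isBigO_cube_iff {ψ : E → F} {u : E} (hψ : ContDiffAt ℝ ∞ ψ u) (l : F →L[ℝ] ℝ)
    (b : F →L[ℝ] F →L[ℝ] ℝ) :
    ((fun s => l (ψ s - ψ u) - b (ψ s - ψ u) (ψ s - ψ u)) =O[𝓝 u] fun s => ‖s - u‖ ^ 3) ↔
      ∀ h, l (fderiv ℝ ψ u h) = 0 ∧
        (1 / 2) * l (fderiv ℝ (fderiv ℝ ψ) u h h) = b (fderiv ℝ ψ u h) (fderiv ℝ ψ u h) := by
  set A := fderiv ℝ ψ u with hA
  set B := fderiv ℝ (fderiv ℝ ψ) u with hB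
  have hT := taylor_two hψ
  have h1 : (fun s => ψ s - ψ u) =O[𝓝 u] fun s => ‖s - u‖ :=
    ((hψ.differentiableAt (by simp)).isBigO_sub).norm_right
  have hAO : (fun s => A (s - u)) =O[𝓝 u] fun s => ‖s - u‖ :=
    (A.isBigO_sub _ _).norm_right
  have h2 : (fun s => ψ s - ψ u - A (s - u)) =O[𝓝 u] fun s => ‖s - u‖ ^ 2 := by
    have hB2 : (fun s => (1 / 2 : ℝ) • B (s - u) (s - u)) =O[𝓝 u] fun s => ‖s - u‖ ^ 2 := by
      refine (IsBigO.of_bound ‖B‖ (Eventually.of_forall fun s => ?_)).const_smul_left (1 / 2 : ℝ)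
      simpa [pow_two, mul_assoc] using B.le_opNorm₂ (s - u) (s - u)
    have h3 : (fun s => ‖s - u‖ ^ 3) =O[𝓝 u] fun s => ‖s - u‖ ^ 2 := by
      have : (fun s => ‖s - u‖) =O[𝓝 u] fun _ => (1 : ℝ) := by
        have hc : ContinuousAt (fun s => ‖s - u‖) u := by fun_prop
        exact hc.isBigO_one ℝ
      simpa [pow_succ _ 2] using (isBigO_refl (fun s => ‖s - u‖ ^ 2) (𝓝 u)).mul this
    refine ((hT.trans h3).add hB2).congr_left fun s => ?_
    abel
  -- With `f = ψ s - ψ u`, this is `b(f - A, f) + b(A, f - A)`: in each summand one factor has order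
  -- two and the other order one.
  have hb : (fun s => b (ψ s - ψ u) (ψ s - ψ u) - b (A (s - u)) (A (s - u))) =O[𝓝 u]
      fun s => ‖s - u‖ ^ 3 := by
    have hbb : ∀ f g : E → F, (fun s => b (f s) (g s)) =O[𝓝 u] fun s => ‖f s‖ * ‖g s‖ := by
      intro f g
      refine IsBigO.of_bound ‖b‖ (Eventually.of_forall fun s => ?_)
      simpa [mul_assoc] using b.le_opNorm₂ (f s) (g s)
    have e1 := (hbb (fun s => ψ s - ψ u - A (s - u)) fun s => ψ s - ψ u).trans
      (h2.norm_left.mul h1.norm_left)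
    have e2 := (hbb (fun s => A (s - u)) fun s => ψ s - ψ u - A (s - u)).trans
      (hAO.norm_left.mul h2.norm_left)
    have e3 := (e1.congr_right fun s => (pow_succ ‖s - u‖ 2).symm).add
      (e2.congr_right fun s => (pow_succ' ‖s - u‖ 2).symm)
    refine e3.congr_left fun s => ?_
    simp only [map_sub, sub_apply]
    ring
  have hl : (fun s => l (ψ s - ψ u) - (l (A (s - u)) + (1 / 2) * l (B (s - u) (s - u)))) =O[𝓝 u]
      fun s => ‖s - u‖ ^ 3 := by
    refine ((l.isBigO_comp _ _).trans hT).congr_left fun s => ?_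
    simp only [map_sub, map_smul, smul_eq_mul]
    ring
  have key : (fun s => (l (ψ s - ψ u) - b (ψ s - ψ u) (ψ s - ψ u)) -
      (l (A (s - u)) + ((1 / 2) * l (B (s - u) (s - u)) - b (A (s - u)) (A (s - u))))) =O[𝓝 u]
      fun s => ‖s - u‖ ^ 3 := (hl.sub hb).congr_left fun s => by ring
  constructor
  · intro hO h
    have := eq_zero_of_isBigO_cube (L := fun h => l (A h))
      (Q := fun h => (1 / 2) * l (B h h) - b (A h) (A h)) (u := u) (fun t h => by simp)
      (fun t h => by simp; ring) ((hO.sub key).congr_left fun s => by ring) h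
    exact ⟨this.1, sub_eq_zero.1 this.2⟩
  · intro hh
    refine key.congr_left fun s => ?_
    rw [(hh (s - u)).1, (hh (s - u)).2]
    ring

end Jets

/-! ## The conormal and the Blaschke metric at a point -/

/-- The conormal at `u` as a continuous linear form. -/
def conormalCLM (ψ : Par n → Aff n) (u : Par n) : Aff n →L[ℝ] ℝ :=
  LinearMap.toContinuousLinearMap
    { toFun := conormal ψ u
      map_add' := fun v w => by simp only [conormal, frameVol_add, mul_add]
      map_smul' := fun c v => by
        simp only [conormal, frameVol_smul, RingHom.id_apply, smul_eq_mul]; ring }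

@[simp] theorem conormalCLM_apply (ψ : Par n → Aff n) (u : Par n) (v : Aff n) :
    conormalCLM ψ u v = conormal ψ u v := rfl

theorem conormal_add (ψ : Par n → Aff n) (u : Par n) (v w : Aff n) :
    conormal ψ u (v + w) = conormal ψ u v + conormal ψ u w := map_add (conormalCLM ψ u) v w

theorem conormal_sub (ψ : Par n → Aff n) (u : Par n) (v w : Aff n) :
    conormal ψ u (v - w) = conormal ψ u v - conormal ψ u w := map_sub (conormalCLM ψ u) v w

theorem conormal_neg (ψ : Par n → Aff n) (u : Par n) (v : Aff n) :
    conormal ψ u (-v) = -conormal ψ u v := map_neg (conormalCLM ψ u) v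

theorem conormal_smul (ψ : Par n → Aff n) (u : Par n) (c : ℝ) (v : Aff n) :
    conormal ψ u (c • v) = c * conormal ψ u v := map_smul (conormalCLM ψ u) c v

theorem conormal_zero (ψ : Par n → Aff n) (u : Par n) : conormal ψ u 0 = 0 :=
  map_zero (conormalCLM ψ u)

theorem conormal_tangent (ψ : Par n → Aff n) (u a : Par n) :
    conormal ψ u (fderiv ℝ ψ u a) = 0 := by
  rw [conormal, frameVol_tangent, mul_zero]

theorem blaschkeMetric_eq (ψ : Par n → Aff n) (u a b : Par n) :
    blaschkeMetric ψ u a b = conormal ψ u (fderiv ℝ (fderiv ℝ ψ) u a b) := rfl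

theorem blaschkeMetric_sub_smul_left (ψ : Par n → Aff n) (u a b c : Par n) (t : ℝ) :
    blaschkeMetric ψ u (a - t • b) c = blaschkeMetric ψ u a c - t * blaschkeMetric ψ u b c := by
  simp only [blaschkeMetric_eq, map_sub, map_smul, sub_apply, smul_apply, conormal_sub,
    conormal_smul]

theorem blaschkeMetric_smul_smul (ψ : Par n → Aff n) (u a b : Par n) (s t : ℝ) :
    blaschkeMetric ψ u (s • a) (t • b) = s * t * blaschkeMetric ψ u a b := by
  simp only [blaschkeMetric_eq, map_smul, smul_apply, conormal_smul]
  ring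

/-- `ψ` is near `u` a smooth immersion whose Blaschke metric at `u` is definite. -/
structure IsConvexAt (ψ : Par n → Aff n) (u : Par n) : Prop where
  smooth : ContDiffAt ℝ ∞ ψ u
  immersion : Function.Injective (fderiv ℝ ψ u)
  definite : (∀ a : Par n, a ≠ 0 → 0 < blaschkeMetric ψ u a a) ∨
    (∀ a : Par n, a ≠ 0 → blaschkeMetric ψ u a a < 0)

theorem Patch.isConvexAt {S : Set (Aff n)} (hS : IsLocallyConvex S) (P : Patch S) {u : Par n}
    (hu : u ∈ P.dom) : IsConvexAt P.ψ u :=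
  ⟨P.smooth.contDiffAt (P.isOpen_dom.mem_nhds hu), P.immersion u hu, hS P u hu⟩

namespace IsConvexAt

variable {ψ : Par n → Aff n} {u : Par n}

theorem metric_ne_zero (H : IsConvexAt ψ u) {a : Par n} (ha : a ≠ 0) :
    blaschkeMetric ψ u a a ≠ 0 := by
  rcases H.definite with h | h
  · exact (h a ha).ne'
  · exact (h a ha).ne

theorem metric_symm (H : IsConvexAt ψ u) (a b : Par n) :
    blaschkeMetric ψ u a b = blaschkeMetric ψ u b a := by
  rw [blaschkeMetric_eq, blaschkeMetric_eq]
  exact congrArg _ (H.smooth.isSymmSndFDerivAt (by simpa using two_le_infty) a b)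

theorem factor_ne_zero (H : IsConvexAt ψ u) : blaschkeFactor ψ u ≠ 0 := fun h =>
  H.metric_ne_zero (a := 1) one_ne_zero (by rw [blaschkeMetric, h, zero_mul])

/-- Nonvanishing here is what makes the factor `|det L|^(-1/(N+2))` differentiable. -/
theorem det_ne_zero (H : IsConvexAt ψ u) : Matrix.det (Matrix.of fun i j : Fin (n + 1) =>
    frameForm ψ u (Pi.single i 1) (Pi.single j 1)) ≠ 0 := by
  intro h
  refine H.factor_ne_zero ?_
  -- `Real.rpow` sends `0` to `0` for every nonzero exponent, even a negative one, so a degenerate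
  -- frame form would make the Blaschke metric zero, contrary to definiteness.
  rw [blaschkeFactor, h, abs_zero, Real.zero_rpow]
  have : (n : ℝ) + 3 ≠ 0 := by positivity
  exact div_ne_zero (by norm_num) this

/-- The kernel of the conormal is the tangent space. -/
theorem mem_tangentDir_iff (H : IsConvexAt ψ u) {v : Aff n} :
    v ∈ tangentDir ψ u ↔ conormal ψ u v = 0 := by
  constructor
  · rintro ⟨a, rfl⟩
    exact conormal_tangent ψ u a
  · intro h
    by_contra hv
    -- A vector outside the tangent space completes the frame to a basis, so its frame volume, and
    -- with it the conormal, is nonzero.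
    have hb : LinearIndependent ℝ (fun i : Fin (n + 1) => fderiv ℝ ψ u (Pi.single i 1)) := by
      have := (Pi.basisFun ℝ (Fin (n + 1))).linearIndependent.map' (fderiv ℝ ψ u).toLinearMap
        (LinearMap.ker_eq_bot.2 H.immersion)
      simpa [Function.comp_def] using this
    have hs : LinearIndependent ℝ (Fin.snoc (α := fun _ => Aff n)
        (fun i : Fin (n + 1) => fderiv ℝ ψ u (Pi.single i 1)) v) := by
      refine linearIndependent_finSnoc.2 ⟨hb, fun hm => hv ?_⟩
      refine (Submodule.span_le.2 ?_) hm
      rintro _ ⟨i, rfl⟩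
      exact ⟨_, rfl⟩
    have hu' : IsUnit (Matrix.of (Fin.snoc (α := fun _ => Aff n)
        (fun i : Fin (n + 1) => fderiv ℝ ψ u (Pi.single i 1)) v)) :=
      Matrix.linearIndependent_rows_iff_isUnit.1 hs
    exact mul_ne_zero H.factor_ne_zero ((Matrix.isUnit_iff_isUnit_det _).1 hu').ne_zero h

theorem exists_fderiv_eq (H : IsConvexAt ψ u) {v : Aff n} (hv : conormal ψ u v = 0) :
    ∃ a, fderiv ℝ ψ u a = v := H.mem_tangentDir_iff.2 hv

end IsConvexAt

/-! ## Differentiation of the conormal -/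

theorem differentiableAt_det {E ι : Type*} [NormedAddCommGroup E] [NormedSpace ℝ E] [Fintype ι]
    [DecidableEq ι] {A : E → Matrix ι ι ℝ} {u : E}
    (hA : ∀ i j, DifferentiableAt ℝ (fun s => A s i j) u) :
    DifferentiableAt ℝ (fun s => (A s).det) u := by
  simp only [Matrix.det_apply]
  refine DifferentiableAt.fun_sum fun σ _ => ?_
  have : DifferentiableAt ℝ (fun s => ∏ i, A s (σ i) i) u := by
    have := (HasFDerivAt.finsetProd (u := Finset.univ)
      fun i _ => (hA (σ i) i).hasFDerivAt).differentiableAt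
    simpa only [Finset.prod_fn] using this
  simpa only [Units.smul_def, zsmul_eq_mul] using this.const_mul ((Equiv.Perm.sign σ : ℤ) : ℝ)

theorem differentiableAt_frameVol {ψ : Par n → Aff n} {u : Par n} (hψ : ContDiffAt ℝ ∞ ψ u)
    {v : Par n → Aff n} (hv : DifferentiableAt ℝ v u) :
    DifferentiableAt ℝ (fun s => frameVol ψ s (v s)) u := by
  refine differentiableAt_det fun i j => ?_
  have h1 : DifferentiableAt ℝ (fderiv ℝ ψ) u :=
    (hψ.fderiv_right (m := ∞) (by simp)).differentiableAt (by simp)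
  refine Fin.lastCases ?_ (fun i => ?_) i
  · simpa using (differentiableAt_pi.1 hv) j
  · simpa using (differentiableAt_pi.1 (h1.clm_apply (differentiableAt_const (Pi.single i 1)))) j

/-- Only the existence of this derivative matters; its value is never computed. -/
theorem IsConvexAt.differentiableAt_conormal {ψ : Par n → Aff n} {u : Par n}
    (H : IsConvexAt ψ u) (v : Aff n) : DifferentiableAt ℝ (fun s => conormal ψ s v) u := by
  have h2 : DifferentiableAt ℝ (fderiv ℝ (fderiv ℝ ψ)) u :=
    ((H.smooth.fderiv_right (m := ∞) (by simp)).fderiv_right (m := ∞)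
      (by simp)).differentiableAt (by simp)
  have hdet := differentiableAt_det (A := fun s => Matrix.of fun i j : Fin (n + 1) =>
    frameForm ψ s (Pi.single i 1) (Pi.single j 1)) (u := u) fun i j =>
      differentiableAt_frameVol H.smooth ((h2.clm_apply (differentiableAt_const
        (Pi.single i 1))).clm_apply (differentiableAt_const (Pi.single j 1)))
  have hφ : DifferentiableAt ℝ (blaschkeFactor ψ) u :=
    (hdet.abs H.det_ne_zero).rpow_const (Or.inl (abs_ne_zero.2 H.det_ne_zero))
  exact hφ.mul (differentiableAt_frameVol H.smooth (differentiableAt_const v))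

/-- Where `v` vanishes, the derivative of `ν(v)` is `ν(v')`. -/
theorem IsConvexAt.hasFDerivAt_conormal {ψ : Par n → Aff n} {u : Par n} (H : IsConvexAt ψ u)
    {v : Par n → Aff n} {v' : Par n →L[ℝ] Aff n} (hv : HasFDerivAt v v' u) (h0 : v u = 0) :
    HasFDerivAt (fun s => conormal ψ s (v s)) ((conormalCLM ψ u).comp v') u := by
  -- In coordinates the product rule applies, and every term with a derivative of the conormal
  -- carries a factor `v u = 0`.
  have hexp : ∀ s (x : Aff n), conormal ψ s x = ∑ i, x i * conormal ψ s (Pi.single i 1) := by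
    intro s x
    have := (conormalCLM ψ s).toLinearMap.pi_apply_eq_sum_univ x
    have hs : ∀ i : Fin (n + 2), (Pi.single i 1 : Aff n) = fun j => if i = j then 1 else 0 := by
      intro i
      ext j
      simp [Pi.single_apply, eq_comm]
    simpa [hs] using this
  have h1 := HasFDerivAt.fun_sum (u := Finset.univ) fun (i : Fin (n + 2)) _ =>
    ((hasFDerivAt_pi'.1 hv) i).mul (H.differentiableAt_conormal (Pi.single i 1)).hasFDerivAt
  have h2 : (fun s => conormal ψ s (v s)) =
      fun s => ∑ i, v s i * conormal ψ s (Pi.single i 1) := funext fun s => hexp s _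
  rw [h2]
  refine h1.congr_fderiv ?_
  ext a
  simp [h0, hexp u (v' a), mul_comm]

/-- The derivative of `F` in the first point, in terms of the vector `w` with
`dψ₁ w = ν₂(C)(X - M) + ν₂(X - M) C`. -/
theorem fderiv_midF {ψ₁ ψ₂ : Par n → Aff n} {u₁ u₂ : Par n} {X : Aff n} (H : IsConvexAt ψ₁ u₁)
    {w : Par n} (hw : fderiv ℝ ψ₁ u₁ w =
      conormal ψ₂ u₂ (midChord (ψ₁ u₁) (ψ₂ u₂)) • (X - midPt (ψ₁ u₁) (ψ₂ u₂)) +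
      conormal ψ₂ u₂ (X - midPt (ψ₁ u₁) (ψ₂ u₂)) • midChord (ψ₁ u₁) (ψ₂ u₂)) (a : Par n) :
    fderiv ℝ (fun s => midF ψ₁ ψ₂ s u₂ X) u₁ a =
      (1 / 2) * conormal ψ₂ u₂ (fderiv ℝ ψ₁ u₁ a) *
        (conormal ψ₁ u₁ (X - midPt (ψ₁ u₁) (ψ₂ u₂)) -
          conormal ψ₁ u₁ (midChord (ψ₁ u₁) (ψ₂ u₂))) - blaschkeMetric ψ₁ u₁ a w := by
  set D := fderiv ℝ ψ₁ u₁
  have hψ : HasFDerivAt ψ₁ D u₁ := (H.smooth.differentiableAt (by simp)).hasFDerivAt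
  have hD : HasFDerivAt (fderiv ℝ ψ₁) (fderiv ℝ (fderiv ℝ ψ₁) u₁) u₁ :=
    ((H.smooth.fderiv_right (m := ∞) (by simp)).differentiableAt (by simp)).hasFDerivAt
  have hC : HasFDerivAt (fun s => midChord (ψ₁ s) (ψ₂ u₂)) ((1 / 2 : ℝ) • D) u₁ :=
    (hψ.sub_const _).fun_const_smul _
  have hV : HasFDerivAt (fun s => X - midPt (ψ₁ s) (ψ₂ u₂)) (-((1 / 2 : ℝ) • D)) u₁ :=
    ((hψ.add_const _).fun_const_smul _).const_sub _
  -- Subtracting `dψ₁(s) w` leaves `ν₁` at `s` unchanged, since that vector is tangent there, and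
  -- makes the argument vanish at `u₁`. Its derivative contributes `-D²ψ₁(a, w)`, hence the metric
  -- term.
  have hW := ((((conormalCLM ψ₂ u₂).hasFDerivAt.comp u₁ hC).smul hV).add
    (((conormalCLM ψ₂ u₂).hasFDerivAt.comp u₁ hV).smul hC)).sub
    (hD.clm_apply (hasFDerivAt_const w u₁))
  have h1 := H.hasFDerivAt_conormal hW (by simp [D, hw] )
  have h2 : (fun s => midF ψ₁ ψ₂ s u₂ X) = fun s => conormal ψ₁ s
      ((conormal ψ₂ u₂ (midChord (ψ₁ s) (ψ₂ u₂)) • (X - midPt (ψ₁ s) (ψ₂ u₂)) +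
      conormal ψ₂ u₂ (X - midPt (ψ₁ s) (ψ₂ u₂)) • midChord (ψ₁ s) (ψ₂ u₂)) -
        fderiv ℝ ψ₁ s w) := by
    funext s
    simp only [midF, conormal_sub, conormal_add, conormal_smul, conormal_tangent]
    ring
  rw [(h1.congr_of_eventuallyEq (EventuallyEq.of_eq h2)).fderiv, blaschkeMetric_eq]
  have ht : conormal ψ₁ u₁ (D a) = 0 := conormal_tangent _ _ _
  simp [conormal_sub, conormal_smul, conormal_neg, ht]
  ring

theorem midChord_swap (p₁ p₂ : Aff n) : midChord p₂ p₁ = -midChord p₁ p₂ := by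
  simp only [midChord, ← smul_neg, neg_sub]

theorem midPt_swap (p₁ p₂ : Aff n) : midPt p₂ p₁ = midPt p₁ p₂ := by
  simp only [midPt, add_comm]

/-- Exchanging the points reverses `C` and fixes `M`. This reduces the derivative in the second
point to the one in the first. -/
theorem midF_swap (ψ₁ ψ₂ : Par n → Aff n) (u₁ u₂ : Par n) (X : Aff n) :
    midF ψ₂ ψ₁ u₂ u₁ X = -midF ψ₁ ψ₂ u₁ u₂ X := by
  simp only [midF, midChord_swap (ψ₁ u₁), midPt_swap (ψ₁ u₁), conormal_neg]
  ring

/-! ## The generating condition in terms of adapted tangent vectors -/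

/-- The conditions on the parameters in the definition of `GeneratesEMH`. -/
structure GeneratesAt (ψ₁ ψ₂ : Par n → Aff n) (u₁ u₂ : Par n) (X : Aff n) : Prop where
  transversal : Transversal ψ₁ ψ₂ u₁ u₂
  not_onZ : ¬ OnZ ψ₁ ψ₂ u₁ u₂ (midPt (ψ₁ u₁) (ψ₂ u₂))
  eq_zero : midF ψ₁ ψ₂ u₁ u₂ X = 0
  fderiv_left : fderiv ℝ (fun s => midF ψ₁ ψ₂ s u₂ X) u₁ = 0
  fderiv_right : fderiv ℝ (fun s => midF ψ₁ ψ₂ u₁ s X) u₂ = 0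

/-- `w` is the parameter of the tangent vector `V - lam C`, which is `h`-orthogonal to `Z` and whose
square length is `lam (1 - lam) ν(C)`. -/
structure IsAdapted (ψ : Par n → Aff n) (u : Par n) (C V : Aff n) (lam : ℝ)
    (Z : Submodule ℝ (Aff n)) (w : Par n) : Prop where
  tangent : fderiv ℝ ψ u w = V - lam • C
  length : blaschkeMetric ψ u w w = lam * (1 - lam) * conormal ψ u C
  orthogonal : OrthogonalTo ψ u w Z

/-- The point `X` and the two tangent spaces are those of a central conic through the two points,
with ratio `lam`, and the curvatures in these directions are those of the conic. -/
structure IsConfiguration (ψ₁ ψ₂ : Par n → Aff n) (u₁ u₂ : Par n) (X : Aff n) (lam : ℝ) :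
    Prop where
  transversal : Transversal ψ₁ ψ₂ u₁ u₂
  left_ne_zero : conormal ψ₁ u₁ (midChord (ψ₁ u₁) (ψ₂ u₂)) ≠ 0
  right_ne_zero : conormal ψ₂ u₂ (midChord (ψ₁ u₁) (ψ₂ u₂)) ≠ 0
  ne_zero : lam ≠ 0
  ne_one : lam ≠ 1
  left : ∃ w, IsAdapted ψ₁ u₁ (midChord (ψ₁ u₁) (ψ₂ u₂)) (X - midPt (ψ₁ u₁) (ψ₂ u₂)) lam
    (tangentDir ψ₁ u₁ ⊓ tangentDir ψ₂ u₂) w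
  right : ∃ w, IsAdapted ψ₂ u₂ (-midChord (ψ₁ u₁) (ψ₂ u₂)) (X - midPt (ψ₁ u₁) (ψ₂ u₂)) lam
    (tangentDir ψ₁ u₁ ⊓ tangentDir ψ₂ u₂) w

variable {ψ₁ ψ₂ : Par n → Aff n} {u₁ u₂ : Par n} {X : Aff n} {lam : ℝ}

theorem Transversal.swap (h : Transversal ψ₁ ψ₂ u₁ u₂) : Transversal ψ₂ ψ₁ u₂ u₁ := by
  rw [Transversal, sup_comm]
  exact h

theorem GeneratesAt.swap (h : GeneratesAt ψ₁ ψ₂ u₁ u₂ X) : GeneratesAt ψ₂ ψ₁ u₂ u₁ X where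
  transversal := h.transversal.swap
  not_onZ := fun hz => h.not_onZ (by rw [midPt_swap] at hz; exact ⟨hz.2, hz.1⟩)
  eq_zero := by rw [midF_swap, h.eq_zero, neg_zero]
  fderiv_left := by
    simp only [midF_swap ψ₁ ψ₂, fderiv_fun_neg, h.fderiv_right, neg_zero]
  fderiv_right := by
    simp only [midF_swap ψ₁ ψ₂, fderiv_fun_neg, h.fderiv_left, neg_zero]

theorem IsConfiguration.swap (h : IsConfiguration ψ₁ ψ₂ u₁ u₂ X lam) :
    IsConfiguration ψ₂ ψ₁ u₂ u₁ X lam where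
  transversal := h.transversal.swap
  left_ne_zero := by
    rw [midChord_swap, conormal_neg]; exact neg_ne_zero.2 h.right_ne_zero
  right_ne_zero := by
    rw [midChord_swap, conormal_neg]; exact neg_ne_zero.2 h.left_ne_zero
  ne_zero := h.ne_zero
  ne_one := h.ne_one
  left := by
    rw [midChord_swap, midPt_swap, inf_comm]; exact h.right
  right := by
    rw [midChord_swap, midPt_swap, inf_comm, neg_neg]; exact h.left

/-- Transversality, in terms of the conormal. -/
theorem Transversal.exists_conormal_ne_zero (h : Transversal ψ₁ ψ₂ u₁ u₂)
    (H₁ : IsConvexAt ψ₁ u₁) : ∃ b, conormal ψ₁ u₁ (fderiv ℝ ψ₂ u₂ b) ≠ 0 := by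
  by_contra! hb
  have hle : tangentDir ψ₁ u₁ ⊔ tangentDir ψ₂ u₂ ≤ tangentDir ψ₁ u₁ := by
    refine sup_le le_rfl ?_
    rintro _ ⟨b, rfl⟩
    exact H₁.mem_tangentDir_iff.2 (hb b)
  rw [show tangentDir ψ₁ u₁ ⊔ tangentDir ψ₂ u₂ = ⊤ from h] at hle
  exact H₁.metric_ne_zero (a := 1) one_ne_zero
    (H₁.mem_tangentDir_iff.1 (hle (Submodule.mem_top (x := fderiv ℝ (fderiv ℝ ψ₁) u₁ 1 1))))

theorem IsConvexAt.eq_zero_of_metric (H : IsConvexAt ψ₁ u₁) {w : Par n}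
    (h : ∀ a, blaschkeMetric ψ₁ u₁ a w = 0) : w = 0 := by
  by_contra hw
  exact H.metric_ne_zero hw (h w)

/-- A vector orthogonal to `Z` represents a multiple of the other conormal. -/
theorem orthogonalTo_and_length_iff (H₁ : IsConvexAt ψ₁ u₁) (H₂ : IsConvexAt ψ₂ u₂) {w : Par n}
    {α β : ℝ} (hβ : β ≠ 0) (h0 : lam ≠ 0) (hw : conormal ψ₂ u₂ (fderiv ℝ ψ₁ u₁ w) = -2 * lam * β) :
    (blaschkeMetric ψ₁ u₁ w w = lam * (1 - lam) * α ∧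
      OrthogonalTo ψ₁ u₁ w (tangentDir ψ₁ u₁ ⊓ tangentDir ψ₂ u₂)) ↔
    ∀ a, β * blaschkeMetric ψ₁ u₁ a w =
      (1 / 2) * conormal ψ₂ u₂ (fderiv ℝ ψ₁ u₁ a) * ((lam - 1) * α) := by
  constructor
  · rintro ⟨hl, ho⟩ a
    -- `w` is transversal to `Z`, because `ν₂` does not kill it; `t` is the coefficient that makes
    -- `a - t w` represent a vector of `Z`.
    set t := conormal ψ₂ u₂ (fderiv ℝ ψ₁ u₁ a) / (-2 * lam * β) with ht
    have hz : conormal ψ₂ u₂ (fderiv ℝ ψ₁ u₁ (a - t • w)) = 0 := by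
      rw [map_sub, map_smul, conormal_sub, conormal_smul, hw, ht]
      field_simp
      ring
    have h1 := ho (a - t • w) ⟨⟨_, rfl⟩, H₂.mem_tangentDir_iff.2 hz⟩
    rw [H₁.metric_symm, blaschkeMetric_sub_smul_left, hl, sub_eq_zero] at h1
    rw [h1, ht]
    field_simp
    ring
  · intro h
    -- Take `a = w` for the length and `a` representing a vector of `Z`, where `ν₂` vanishes, for
    -- orthogonality.
    refine ⟨?_, fun b hb => ?_⟩
    · have := h w
      rw [hw] at this
      refine mul_left_cancel₀ hβ (this.trans ?_)
      ring
    · have := h b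
      rw [H₂.mem_tangentDir_iff.1 hb.2] at this
      rw [H₁.metric_symm]
      simpa [hβ] using this

/-- `F = 0` says that `ν₁` kills the vector on the right, so it is tangent at the first point; then
`fderiv_midF` turns `F_{p₁} = 0` into the metric identity. -/
theorem GeneratesAt.exists_left (h : GeneratesAt ψ₁ ψ₂ u₁ u₂ X) (H₁ : IsConvexAt ψ₁ u₁) :
    ∃ w, fderiv ℝ ψ₁ u₁ w =
      conormal ψ₂ u₂ (midChord (ψ₁ u₁) (ψ₂ u₂)) • (X - midPt (ψ₁ u₁) (ψ₂ u₂)) +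
      conormal ψ₂ u₂ (X - midPt (ψ₁ u₁) (ψ₂ u₂)) • midChord (ψ₁ u₁) (ψ₂ u₂) ∧
    ∀ a, blaschkeMetric ψ₁ u₁ a w = (1 / 2) * conormal ψ₂ u₂ (fderiv ℝ ψ₁ u₁ a) *
        (conormal ψ₁ u₁ (X - midPt (ψ₁ u₁) (ψ₂ u₂)) -
          conormal ψ₁ u₁ (midChord (ψ₁ u₁) (ψ₂ u₂))) := by
  have h0 := h.eq_zero
  simp only [midF] at h0
  obtain ⟨w, hw⟩ := H₁.exists_fderiv_eq
    (v := conormal ψ₂ u₂ (midChord (ψ₁ u₁) (ψ₂ u₂)) • (X - midPt (ψ₁ u₁) (ψ₂ u₂)) +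
      conormal ψ₂ u₂ (X - midPt (ψ₁ u₁) (ψ₂ u₂)) • midChord (ψ₁ u₁) (ψ₂ u₂)) (by
      simp only [conormal_add, conormal_smul]; linarith)
  refine ⟨w, hw, fun a => ?_⟩
  have := fderiv_midF H₁ hw a
  rw [h.fderiv_left] at this
  simp only [zero_apply] at this
  linarith

/-- `M ∉ Z` only excludes a chord tangent at both points. If it were tangent at the first one alone,
`F = 0` and `F_{p₁} = 0` would force `ν₁(V) = ν₂(V) = 0`, and `F_{p₂} = 0` would then make `ν₁`
vanish on the second tangent space, against transversality. -/
theorem GeneratesAt.left_ne_zero (h : GeneratesAt ψ₁ ψ₂ u₁ u₂ X) (H₁ : IsConvexAt ψ₁ u₁)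
    (H₂ : IsConvexAt ψ₂ u₂) : conormal ψ₁ u₁ (midChord (ψ₁ u₁) (ψ₂ u₂)) ≠ 0 := by
  intro hα
  obtain ⟨w, hw, hwa⟩ := h.exists_left H₁
  obtain ⟨w', hw', hwb⟩ := h.swap.exists_left H₂
  have hz := h.not_onZ
  have h0 := h.eq_zero
  rw [midChord_swap (ψ₁ u₁), midPt_swap (ψ₁ u₁)] at hw' hwb
  simp only [midF, conormal_neg] at h0 hw' hwb
  set C := midChord (ψ₁ u₁) (ψ₂ u₂) with hC
  set V := X - midPt (ψ₁ u₁) (ψ₂ u₂) with hV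
  have e1 : midPt (ψ₁ u₁) (ψ₂ u₂) - ψ₁ u₁ = -C := by
    rw [hC, midPt, midChord]; module
  have e2 : midPt (ψ₁ u₁) (ψ₂ u₂) - ψ₂ u₂ = C := by
    rw [hC, midPt, midChord]; module
  have hβ : conormal ψ₂ u₂ C ≠ 0 := fun hβ => hz
    ⟨by rw [H₁.mem_tangentDir_iff, e1, conormal_neg, hα, neg_zero],
      by rw [H₂.mem_tangentDir_iff, e2, hβ]⟩
  rw [hα, zero_mul, add_zero] at h0
  have hx1 : conormal ψ₁ u₁ V = 0 := (mul_eq_zero.1 h0).resolve_left hβ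
  have hw0 : w = 0 := H₁.eq_zero_of_metric fun a => by rw [hwa, hα, hx1, sub_zero, mul_zero]
  have hx2 : conormal ψ₂ u₂ V = 0 := by
    have := congrArg (conormal ψ₂ u₂) hw
    rw [hw0, map_zero, conormal_zero, conormal_add, conormal_smul, conormal_smul] at this
    have h2 : conormal ψ₂ u₂ C * conormal ψ₂ u₂ V = 0 := by linarith
    exact (mul_eq_zero.1 h2).resolve_left hβ
  have hw0' : w' = 0 := by
    refine H₂.immersion ?_
    rw [hw', hα, hx1, map_zero]
    simp
  obtain ⟨b, hb⟩ := h.transversal.exists_conormal_ne_zero H₁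
  have := hwb b
  rw [hw0', H₂.metric_symm, blaschkeMetric_eq, map_zero, zero_apply,
    conormal_zero, hx2] at this
  have h3 : conormal ψ₁ u₁ (fderiv ℝ ψ₂ u₂ b) * conormal ψ₂ u₂ C = 0 := by linarith
  exact mul_ne_zero hb hβ h3

theorem GeneratesAt.exists_isConfiguration (h : GeneratesAt ψ₁ ψ₂ u₁ u₂ X)
    (H₁ : IsConvexAt ψ₁ u₁) (H₂ : IsConvexAt ψ₂ u₂) :
    ∃ lam, IsConfiguration ψ₁ ψ₂ u₁ u₂ X lam := by
  have hα := h.left_ne_zero H₁ H₂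
  have hβ := h.swap.left_ne_zero H₂ H₁
  rw [midChord_swap, conormal_neg, neg_ne_zero] at hβ
  obtain ⟨w, hw, hwa⟩ := h.exists_left H₁
  obtain ⟨w', hw', hwb⟩ := h.swap.exists_left H₂
  have h0 := h.eq_zero
  rw [midChord_swap (ψ₁ u₁), midPt_swap (ψ₁ u₁)] at hw' hwb
  simp only [midF, conormal_neg] at h0 hw' hwb
  obtain ⟨a, ha⟩ := h.transversal.swap.exists_conormal_ne_zero H₂
  set C := midChord (ψ₁ u₁) (ψ₂ u₂) with hC
  set V := X - midPt (ψ₁ u₁) (ψ₂ u₂) with hV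
  set α := conormal ψ₁ u₁ C with hα'
  set β := conormal ψ₂ u₂ C with hβ'
  -- The ratio is `ν₁(V) / ν₁(C)`; `F = 0` makes it also `-ν₂(V) / ν₂(C)`.
  obtain ⟨lam, hlam⟩ : ∃ lam, conormal ψ₁ u₁ V = lam * α := ⟨_, (div_mul_cancel₀ _ hα).symm⟩
  have hlam2 : conormal ψ₂ u₂ V = -lam * β := by
    rw [hlam] at h0
    refine mul_left_cancel₀ hα ?_
    linarith
  rw [hlam] at hwa
  rw [hlam2] at hwb
  rw [hlam2] at hw
  rw [hlam] at hw'
  have hw1 : fderiv ℝ ψ₁ u₁ (β⁻¹ • w) = V - lam • C := by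
    rw [map_smul, hw, smul_add, smul_smul, smul_smul, inv_mul_cancel₀ hβ,
      show β⁻¹ * (-lam * β) = -lam by field_simp]
    module
  have hw2 : fderiv ℝ ψ₂ u₂ ((-α)⁻¹ • w') = V - lam • -C := by
    rw [map_smul, hw', smul_add, smul_smul, smul_smul, inv_mul_cancel₀ (neg_ne_zero.2 hα),
      show (-α)⁻¹ * (lam * α) = -lam by field_simp]
    module
  have hm1 : ∀ a, β * blaschkeMetric ψ₁ u₁ a (β⁻¹ • w) =
      (1 / 2) * conormal ψ₂ u₂ (fderiv ℝ ψ₁ u₁ a) * ((lam - 1) * α) := by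
    intro a
    have := blaschkeMetric_smul_smul ψ₁ u₁ a w 1 β⁻¹
    rw [one_smul] at this
    rw [this, hwa]
    field_simp
  have hm2 : ∀ b, -α * blaschkeMetric ψ₂ u₂ b ((-α)⁻¹ • w') =
      (1 / 2) * conormal ψ₁ u₁ (fderiv ℝ ψ₂ u₂ b) * ((lam - 1) * -β) := by
    intro a
    have := blaschkeMetric_smul_smul ψ₂ u₂ a w' 1 (-α)⁻¹
    rw [one_smul] at this
    rw [this, hwb]
    field_simp
    ring
  have hn1 : conormal ψ₂ u₂ (fderiv ℝ ψ₁ u₁ (β⁻¹ • w)) = -2 * lam * β := by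
    rw [hw1, conormal_sub, conormal_smul, hlam2]; ring
  have hn2 : conormal ψ₁ u₁ (fderiv ℝ ψ₂ u₂ ((-α)⁻¹ • w')) = -2 * lam * -α := by
    rw [hw2, conormal_sub, conormal_smul, conormal_neg, hlam]; ring
  -- For ratio `0` the tangent vector would be null, hence zero by definiteness, and then `ν₂` would
  -- vanish on the first tangent space.
  have hne0 : lam ≠ 0 := by
    rintro rfl
    have hw0 : β⁻¹ • w = 0 := by
      by_contra hne
      refine H₁.metric_ne_zero hne (mul_left_cancel₀ hβ ?_)
      rw [hm1, hn1]
      ring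
    have := hm1 a
    rw [hw0, H₁.metric_symm, blaschkeMetric_eq, map_zero, zero_apply,
      conormal_zero] at this
    have h3 : conormal ψ₂ u₂ (fderiv ℝ ψ₁ u₁ a) * α = 0 := by linarith
    exact mul_ne_zero ha hα h3
  -- For ratio `1` both metric duals vanish, so `V - C = V + C = 0` and `C = 0`.
  have hne1 : lam ≠ 1 := by
    rintro rfl
    have hw0 : β⁻¹ • w = 0 := H₁.eq_zero_of_metric fun a => by
      refine mul_left_cancel₀ hβ ?_
      rw [hm1]; ring
    have hw0' : (-α)⁻¹ • w' = 0 := H₂.eq_zero_of_metric fun a => by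
      refine mul_left_cancel₀ (neg_ne_zero.2 hα) ?_
      rw [hm2]; ring
    rw [hw0, map_zero] at hw1
    rw [hw0', map_zero] at hw2
    have hC0 : C = 0 := by
      have : (2 : ℝ) • C = (V - (1 : ℝ) • -C) - (V - (1 : ℝ) • C) := by module
      rw [← hw1, ← hw2, sub_zero] at this
      simpa using this
    exact hα (by rw [hα', hC0, conormal_zero])
  refine ⟨lam, h.transversal, hα, hβ, hne0, hne1, ⟨_, hw1, ?_, ?_⟩, ⟨_, hw2, ?_, ?_⟩⟩
  · exact ((orthogonalTo_and_length_iff H₁ H₂ hβ hne0 hn1).2 hm1).1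
  · exact ((orthogonalTo_and_length_iff H₁ H₂ hβ hne0 hn1).2 hm1).2
  · rw [conormal_neg]
    exact ((orthogonalTo_and_length_iff H₂ H₁ (neg_ne_zero.2 hα) hne0 hn2).2 hm2).1
  · rw [inf_comm]
    exact ((orthogonalTo_and_length_iff H₂ H₁ (neg_ne_zero.2 hα) hne0 hn2).2 hm2).2

/-! ### From a configuration back to the envelope equations. -/

theorem IsConfiguration.conormal_left (h : IsConfiguration ψ₁ ψ₂ u₁ u₂ X lam) :
    conormal ψ₁ u₁ (X - midPt (ψ₁ u₁) (ψ₂ u₂)) =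
      lam * conormal ψ₁ u₁ (midChord (ψ₁ u₁) (ψ₂ u₂)) := by
  obtain ⟨w, hw⟩ := h.left
  have := congrArg (conormal ψ₁ u₁) hw.tangent
  rw [conormal_tangent, conormal_sub, conormal_smul] at this
  linarith

theorem IsConfiguration.conormal_right (h : IsConfiguration ψ₁ ψ₂ u₁ u₂ X lam) :
    conormal ψ₂ u₂ (X - midPt (ψ₁ u₁) (ψ₂ u₂)) =
      -lam * conormal ψ₂ u₂ (midChord (ψ₁ u₁) (ψ₂ u₂)) := by
  obtain ⟨w, hw⟩ := h.right
  have := congrArg (conormal ψ₂ u₂) hw.tangent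
  rw [conormal_tangent, conormal_sub, conormal_smul, conormal_neg] at this
  linarith

/-- The ratio of a configuration is determined by the points and the tangent spaces. -/
theorem IsConfiguration.unique {lam' : ℝ} (h : IsConfiguration ψ₁ ψ₂ u₁ u₂ X lam)
    (h' : IsConfiguration ψ₁ ψ₂ u₁ u₂ X lam') : lam = lam' :=
  mul_right_cancel₀ h.left_ne_zero (h.conormal_left.symm.trans h'.conormal_left)

theorem IsConfiguration.midF_eq_zero (h : IsConfiguration ψ₁ ψ₂ u₁ u₂ X lam) :
    midF ψ₁ ψ₂ u₁ u₂ X = 0 := by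
  rw [midF]
  rw [h.conormal_left, h.conormal_right]
  ring

theorem IsConfiguration.fderiv_left (h : IsConfiguration ψ₁ ψ₂ u₁ u₂ X lam)
    (H₁ : IsConvexAt ψ₁ u₁) (H₂ : IsConvexAt ψ₂ u₂) :
    fderiv ℝ (fun s => midF ψ₁ ψ₂ s u₂ X) u₁ = 0 := by
  obtain ⟨w, hw⟩ := h.left
  have hr := h.conormal_right
  have hl := h.conormal_left
  have hβ := h.right_ne_zero
  set C := midChord (ψ₁ u₁) (ψ₂ u₂) with hC
  set V := X - midPt (ψ₁ u₁) (ψ₂ u₂) with hV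
  set β := conormal ψ₂ u₂ C with hβ'
  have hn : conormal ψ₂ u₂ (fderiv ℝ ψ₁ u₁ w) = -2 * lam * β := by
    rw [hw.tangent, conormal_sub, conormal_smul, hr]
    ring
  ext a
  -- The adapted vector is normalized to represent `V - lam C`; the factor `β = ν₂(C)` restores the
  -- vector of `fderiv_midF`.
  rw [fderiv_midF (w := β • w) H₁ (by
    rw [map_smul, hw.tangent, hr]; module)]
  have := (orthogonalTo_and_length_iff H₁ H₂ hβ h.ne_zero hn).1 ⟨hw.length, hw.orthogonal⟩ a
  have h1 := blaschkeMetric_smul_smul ψ₁ u₁ a w 1 β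
  rw [one_smul, one_mul] at h1
  rw [h1, this, hl, zero_apply]
  ring

theorem IsConfiguration.generatesAt (h : IsConfiguration ψ₁ ψ₂ u₁ u₂ X lam)
    (H₁ : IsConvexAt ψ₁ u₁) (H₂ : IsConvexAt ψ₂ u₂) : GeneratesAt ψ₁ ψ₂ u₁ u₂ X where
  transversal := h.transversal
  not_onZ := fun hz => by
    refine h.right_ne_zero ?_
    have := H₂.mem_tangentDir_iff.1 hz.2
    rw [← this]
    congr 1
    rw [midPt, midChord]
    module
  eq_zero := h.midF_eq_zero
  fderiv_left := h.fderiv_left H₁ H₂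
  fderiv_right := by
    have := h.swap.fderiv_left H₂ H₁
    simp only [midF_swap ψ₁ ψ₂, fderiv_fun_neg, neg_eq_zero] at this
    exact this

theorem generatesAt_iff (H₁ : IsConvexAt ψ₁ u₁) (H₂ : IsConvexAt ψ₂ u₂) :
    GeneratesAt ψ₁ ψ₂ u₁ u₂ X ↔ ∃ lam, IsConfiguration ψ₁ ψ₂ u₁ u₂ X lam :=
  ⟨fun h => h.exists_isConfiguration H₁ H₂, fun ⟨_, h⟩ => h.generatesAt H₁ H₂⟩

/-! ## Contact of order three -/

section Curves

variable {E F : Type*} [NormedAddCommGroup E] [NormedSpace ℝ E] [NormedAddCommGroup F]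
  [NormedSpace ℝ F]

theorem eventually_differentiableAt {G : E → F} {u : E} (hG : ContDiffAt ℝ ∞ G u) :
    ∀ᶠ s in 𝓝 u, DifferentiableAt ℝ G s :=
  ((hG.of_le (m := 1) (by simp)).eventually (by simp)).mono
    fun _ hs => hs.differentiableAt (by simp)

theorem contDiffAt_deriv {γ : ℝ → F} {t : ℝ} (h : ContDiffAt ℝ ∞ γ t) :
    ContDiffAt ℝ ∞ (deriv γ) t := by
  have h1 : ContDiffAt ℝ ∞ (fderiv ℝ γ) t := h.fderiv_right (by simp)
  exact h1.clm_apply contDiffAt_const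

theorem deriv_comp_curve {ψ : E → F} {c : ℝ → E} {t : ℝ} (hψ : ContDiffAt ℝ ∞ ψ (c t))
    (hc : ContDiffAt ℝ ∞ c t) :
    deriv (fun s => ψ (c s)) t = fderiv ℝ ψ (c t) (deriv c t) ∧
    deriv (deriv fun s => ψ (c s)) t = fderiv ℝ (fderiv ℝ ψ) (c t) (deriv c t) (deriv c t) +
      fderiv ℝ ψ (c t) (deriv (deriv c) t) := by
  have h1 : ∀ᶠ s in 𝓝 t, deriv (fun s => ψ (c s)) s = fderiv ℝ ψ (c s) (deriv c s) := by
    filter_upwards [eventually_differentiableAt hc,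
      hc.continuousAt.eventually (eventually_differentiableAt hψ)] with s h2 h3
    exact (h3.hasFDerivAt.comp_hasDerivAt s h2.hasDerivAt).deriv
  refine ⟨h1.self_of_nhds, ?_⟩
  rw [EventuallyEq.deriv_eq h1]
  have hψ1 : DifferentiableAt ℝ (fderiv ℝ ψ) (c t) :=
    (hψ.fderiv_right (m := ∞) (by simp)).differentiableAt (by simp)
  exact ((hψ1.hasFDerivAt.comp_hasDerivAt t (hc.differentiableAt (by simp)).hasDerivAt).clm_apply
    ((contDiffAt_deriv hc).differentiableAt (by simp)).hasDerivAt).deriv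

theorem iteratedDeriv_two_eq (γ : ℝ → F) : iteratedDeriv 2 γ = deriv (deriv γ) := by
  rw [iteratedDeriv_succ, iteratedDeriv_one]

end Curves

/-- Contact of order three, in terms of the conormal. -/
theorem makesContact_three_iff {K : Set (Aff n)} {ψ : Par n → Aff n} {u a : Par n}
    (H : IsConvexAt ψ u) : MakesContact 3 K ψ u a ↔ a ≠ 0 ∧ ∃ γ : ℝ → Aff n,
      ContDiffAt ℝ ∞ γ 0 ∧ (∀ᶠ t in 𝓝 0, γ t ∈ K) ∧ γ 0 = ψ u ∧ deriv γ 0 = fderiv ℝ ψ u a ∧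
      conormal ψ u (deriv (deriv γ) 0) = blaschkeMetric ψ u a a := by
  constructor
  · rintro ⟨ha, γ, c, hγ, hK, hγ1, hc, rfl, hj⟩
    have h0 := hj 0 (by norm_num)
    have h1 := hj 1 (by norm_num)
    have h2 := hj 2 (by norm_num)
    rw [iteratedDeriv_zero, iteratedDeriv_zero] at h0
    rw [iteratedDeriv_one, iteratedDeriv_one] at h1
    rw [iteratedDeriv_two_eq, iteratedDeriv_two_eq] at h2
    obtain ⟨d1, d2⟩ := deriv_comp_curve H.smooth hc
    have hca : deriv c 0 = a := H.immersion (by rw [← d1, ← h1, hγ1])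
    refine ⟨ha, γ, hγ, hK, h0, hγ1, ?_⟩
    rw [h2, d2, conormal_add, conormal_tangent, add_zero, hca, blaschkeMetric_eq]
  · rintro ⟨ha, γ, hγ, hK, h0, h1, h2⟩
    -- Equal conormal components leave a tangential difference `dψ e` of accelerations, which the
    -- term `(t² / 2) e` of the parameter curve absorbs.
    obtain ⟨e, he⟩ := H.exists_fderiv_eq
      (v := deriv (deriv γ) 0 - fderiv ℝ (fderiv ℝ ψ) u a a) (by
        rw [conormal_sub, h2, blaschkeMetric_eq, sub_self])
    set c : ℝ → Par n := fun t => u + t • a + (t ^ 2 / 2) • e with hcdef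
    have hc : ContDiffAt ℝ ∞ c 0 := by
      refine (contDiffAt_const.add (contDiffAt_id.smul contDiffAt_const)).add
        (((contDiffAt_id.pow 2).div_const 2).smul contDiffAt_const)
    have hc0 : c 0 = u := by simp [hcdef]
    have hc1 : deriv c = fun t => a + t • e := by
      funext t
      have h := (((hasDerivAt_const t u).add ((hasDerivAt_id t).smul_const a)).add
        ((((hasDerivAt_id t).pow 2).div_const 2).smul_const e))
      refine h.deriv.trans ?_
      simp
    have hc2 : deriv (deriv c) 0 = e := by
      rw [hc1]
      have h := (hasDerivAt_const (0 : ℝ) a).add ((hasDerivAt_id (0 : ℝ)).smul_const e)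
      refine h.deriv.trans ?_
      simp
    refine ⟨ha, γ, c, hγ, hK, h1, hc, hc0, ?_⟩
    have hψ : ContDiffAt ℝ ∞ ψ (c 0) := by rw [hc0]; exact H.smooth
    obtain ⟨d1, d2⟩ := deriv_comp_curve hψ hc
    rw [hc2, hc1, hc0] at d2
    rw [hc1, hc0] at d1
    simp only [zero_smul, add_zero] at d1 d2
    intro j hj
    interval_cases j
    · rw [iteratedDeriv_zero, iteratedDeriv_zero, h0, hc0]
    · rw [iteratedDeriv_one, iteratedDeriv_one, d1, h1]
    · rw [iteratedDeriv_two_eq, iteratedDeriv_two_eq, d2, he]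
      abel

/-! ## From a contact conic to a configuration -/

theorem exists_coordinates {v w : Aff n} (h : LinearIndependent ℝ ![v, w]) :
    ∃ A B : Aff n →L[ℝ] ℝ, A v = 1 ∧ A w = 0 ∧ B v = 0 ∧ B w = 1 := by
  obtain ⟨g, hg⟩ := (Fintype.linearCombination ℝ ![v, w]).exists_leftInverse_of_injective
    (LinearMap.ker_eq_bot.2 (linearIndependent_iff_injective_fintypeLinearCombination.1 h))
  have hv : g v = Pi.single 0 1 := by
    have := LinearMap.congr_fun hg (Pi.single 0 1)
    simpa using this
  have hw : g w = Pi.single 1 1 := by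
    have := LinearMap.congr_fun hg (Pi.single 1 1)
    simpa using this
  refine ⟨((LinearMap.proj 0).comp g).toContinuousLinearMap,
    ((LinearMap.proj 1).comp g).toContinuousLinearMap, ?_, ?_, ?_, ?_⟩ <;>
  simp [hv, hw]

/-- The 2-jet of a curve on a central conic. -/
theorem jet_of_conic {v w X : Aff n} {σ : ℝ} (h : LinearIndependent ℝ ![v, w]) {γ : ℝ → Aff n}
    (hγ : ContDiffAt ℝ ∞ γ 0)
    (hK : ∀ᶠ t in 𝓝 0, ∃ a b : ℝ, a ^ 2 + σ * b ^ 2 = 1 ∧ γ t = X + a • v + b • w) :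
    ∃ a₀ b₀ a₁ b₁ a₂ b₂ : ℝ, γ 0 = X + a₀ • v + b₀ • w ∧ deriv γ 0 = a₁ • v + b₁ • w ∧
      deriv (deriv γ) 0 = a₂ • v + b₂ • w ∧ a₀ ^ 2 + σ * b₀ ^ 2 = 1 ∧
      a₀ * a₁ + σ * (b₀ * b₁) = 0 ∧
      a₁ ^ 2 + σ * b₁ ^ 2 + (a₀ * a₂ + σ * (b₀ * b₂)) = 0 := by
  obtain ⟨A, B, hAv, hAw, hBv, hBw⟩ := exists_coordinates h
  -- The conic supplies its coordinates pointwise only; linear forms dual to `v`, `w` recover them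
  -- as smooth functions of `t`.
  set a : ℝ → ℝ := fun t => A (γ t - X) with ha
  set b : ℝ → ℝ := fun t => B (γ t - X) with hb
  have hac : ContDiffAt ℝ ∞ a 0 := A.contDiff.contDiffAt.comp 0 (hγ.sub contDiffAt_const)
  have hbc : ContDiffAt ℝ ∞ b 0 := B.contDiff.contDiffAt.comp 0 (hγ.sub contDiffAt_const)
  have hK' : ∀ᶠ t in 𝓝 0, a t ^ 2 + σ * b t ^ 2 = 1 ∧ γ t = X + a t • v + b t • w := by
    filter_upwards [hK] with t ht
    obtain ⟨x, y, hxy, hγt⟩ := ht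
    have e1 : a t = x := by
      simp only [ha, hγt, map_sub, map_add, map_smul, hAv, hAw, smul_eq_mul]; ring
    have e2 : b t = y := by
      simp only [hb, hγt, map_sub, map_add, map_smul, hBv, hBw, smul_eq_mul]; ring
    rw [e1, e2]
    exact ⟨hxy, hγt⟩
  have hda := eventually_differentiableAt hac
  have hdb := eventually_differentiableAt hbc
  have hda' := ((contDiffAt_deriv hac).differentiableAt (by simp)).hasDerivAt
  have hdb' := ((contDiffAt_deriv hbc).differentiableAt (by simp)).hasDerivAt
  have hg1 : ∀ᶠ t in 𝓝 0, deriv γ t = deriv a t • v + deriv b t • w := by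
    filter_upwards [hda, hdb, hK'.eventually_nhds] with t h1 h2 h3
    rw [EventuallyEq.deriv_eq (h3.mono fun s hs => hs.2)]
    exact (((h1.hasDerivAt.smul_const v).const_add X).add (h2.hasDerivAt.smul_const w)).deriv
  have hq1 : ∀ᶠ t in 𝓝 0, a t * deriv a t + σ * (b t * deriv b t) = 0 := by
    filter_upwards [hda, hdb, hK'.eventually_nhds] with t h1 h2 h3
    have h4 := EventuallyEq.deriv_eq (h3.mono fun s hs => hs.1)
    rw [deriv_const, ((h1.hasDerivAt.fun_pow 2).fun_add ((h2.hasDerivAt.fun_pow 2).const_mul σ)).deriv]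
      at h4
    simp only [Nat.cast_ofNat, Nat.add_one_sub_one, pow_one] at h4
    linarith
  refine ⟨a 0, b 0, deriv a 0, deriv b 0, deriv (deriv a) 0, deriv (deriv b) 0,
    hK'.self_of_nhds.2, hg1.self_of_nhds, ?_, hK'.self_of_nhds.1, hq1.self_of_nhds, ?_⟩
  · rw [EventuallyEq.deriv_eq hg1]
    exact ((hda'.smul_const v).add (hdb'.smul_const w)).deriv
  · have h4 := EventuallyEq.deriv_eq hq1
    rw [deriv_const, ((hda.self_of_nhds.hasDerivAt.fun_mul hda').fun_add
      ((hdb.self_of_nhds.hasDerivAt.fun_mul hdb').const_mul σ)).deriv] at h4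
    linarith

/-- The direction and the curvature of a central conic at the end of a chord: here `(c₁, c₂)` is
the half chord, and `(v₁, v₂)` goes from its mid-point to the center. -/
theorem conic_curvature {σ c₁ c₂ v₁ v₂ a₁ b₁ a₂ b₂ P R : ℝ} (hP : P = v₁ ^ 2 + σ * v₂ ^ 2) (hR : R = c₁ ^ 2 + σ * c₂ ^ 2) (hPR : P + R = 1)
    (hB : c₁ * v₁ + σ * (c₂ * v₂) = 0) (hR0 : R ≠ 0)
    (hY : a₁ ≠ 0 ∨ b₁ ≠ 0) (h1 : (c₁ - v₁) * a₁ + σ * ((c₂ - v₂) * b₁) = 0)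
    (h2 : a₁ ^ 2 + σ * b₁ ^ 2 + ((c₁ - v₁) * a₂ + σ * ((c₂ - v₂) * b₂)) = 0) :
    ∃ κ t : ℝ, κ * a₁ = v₁ - (-P / R) * c₁ ∧ κ * b₁ = v₂ - (-P / R) * c₂ ∧
      κ ^ 2 * a₂ = (-P / R) * (1 - (-P / R)) * c₁ + t * a₁ ∧
      κ ^ 2 * b₂ = (-P / R) * (1 - (-P / R)) * c₂ + t * b₁ := by
  have hQ : (c₁ - v₁) ^ 2 + σ * (c₂ - v₂) ^ 2 = 1 := by
    linear_combination hPR - hP - hR - 2 * hB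
  -- With `q = C - V`, the point seen from the center, and `Q(x, y) = x² + σ y²`, every vector is
  -- expanded in the `Q`-orthogonal basis `q`, `J q`, where `J(x, y) = (-σ y, x)`. Tangents to the
  -- conic are multiples of `J q`.
  have hJ : ∀ e f : ℝ, e = ((c₁ - v₁) * e + σ * ((c₂ - v₂) * f)) * (c₁ - v₁) +
        ((c₁ - v₁) * f - (c₂ - v₂) * e) * (-σ * (c₂ - v₂)) ∧
      f = ((c₁ - v₁) * e + σ * ((c₂ - v₂) * f)) * (c₂ - v₂) +
        ((c₁ - v₁) * f - (c₂ - v₂) * e) * (c₁ - v₁) := fun e f =>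
    ⟨by linear_combination -e * hQ, by linear_combination -f * hQ⟩
  set μ := (c₁ - v₁) * b₁ - (c₂ - v₂) * a₁ with hμ
  have ea : a₁ = μ * (-σ * (c₂ - v₂)) := by
    have := (hJ a₁ b₁).1
    rwa [h1, zero_mul, zero_add] at this
  have eb : b₁ = μ * (c₁ - v₁) := by
    have := (hJ a₁ b₁).2
    rwa [h1, zero_mul, zero_add] at this
  have hμ0 : μ ≠ 0 := by
    intro h0
    rw [h0, zero_mul] at ea eb
    exact hY.elim (fun h => h ea) fun h => h eb
  set d := c₁ * v₂ - c₂ * v₁ with hd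
  -- The Lagrange identity for `Q`, with `C` and `V` conjugate.
  have hdd : d ^ 2 * σ = P * R := by
    rw [hP, hR, hd]
    linear_combination -(c₁ * v₁ + σ * (c₂ * v₂)) * hB
  -- `R V + P C` is conjugate to `C - V`, hence tangent. Divided by `R` it is `V - lam C` with `lam
  -- = -P / R`.
  have hE := hJ (R * v₁ + P * c₁) (R * v₂ + P * c₂)
  have hE0 : (c₁ - v₁) * (R * v₁ + P * c₁) + σ * ((c₂ - v₂) * (R * v₂ + P * c₂)) = 0 := by
    linear_combination (R - P) * hB - P * hR + R * hP
  have hE1 : (c₁ - v₁) * (R * v₂ + P * c₂) - (c₂ - v₂) * (R * v₁ + P * c₁) = d := by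
    rw [hd]
    linear_combination (c₁ * v₂ - c₂ * v₁) * hPR
  simp only [hE0, hE1, zero_mul, zero_add] at hE
  have hQY : a₁ ^ 2 + σ * b₁ ^ 2 = σ * μ ^ 2 := by
    rw [ea, eb]
    linear_combination σ * μ ^ 2 * hQ
  have k1 : d / (μ * R) * a₁ = v₁ - (-P / R) * c₁ := by
    rw [ea]
    field_simp
    linear_combination -hE.1
  have k2 : d / (μ * R) * b₁ = v₂ - (-P / R) * c₂ := by
    rw [eb]
    field_simp
    linear_combination -hE.2
  have hκ : (d / (μ * R)) ^ 2 * (-(σ * μ ^ 2)) = -P / R := by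
    field_simp
    linear_combination -hdd
  have hg : (c₁ - v₁) * a₂ + σ * ((c₂ - v₂) * b₂) = -(σ * μ ^ 2) := by linarith
  have hG := hJ a₂ b₂
  rw [hg] at hG
  set κ := d / (μ * R)
  set lam := -P / R
  set τ := (c₁ - v₁) * b₂ - (c₂ - v₂) * a₂
  have ea' : -σ * (c₂ - v₂) = a₁ / μ := by rw [ea]; field_simp
  have eb' : c₁ - v₁ = b₁ / μ := by rw [eb]; field_simp
  -- The rescaled acceleration has component `lam (C - V)` along the radius, and `lam (C - V) = lam
  -- (1 - lam) C - lam (V - lam C)`; the last term is tangential and enters `t`.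
  refine ⟨κ, -lam * κ + κ ^ 2 * τ / μ, k1, k2, ?_, ?_⟩
  · have := hG.1
    rw [ea'] at this
    linear_combination κ ^ 2 * this + (c₁ - v₁) * hκ + lam * k1
  · have : b₂ = -(σ * μ ^ 2) * (c₂ - v₂) + τ * (b₁ / μ) := by rw [← eb']; exact hG.2
    linear_combination κ ^ 2 * this + (c₂ - v₂) * hκ + lam * k2

/-- The tangents of a central conic at two points on a diameter are parallel. -/
theorem conic_parallel {σ x y x' y' a b a' b' : ℝ} (h : x ^ 2 + σ * y ^ 2 = 1)
    (h' : x' ^ 2 + σ * y' ^ 2 = 1) (hY : x * a + σ * (y * b) = 0)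
    (hY' : x' * a' + σ * (y' * b') = 0) (hd : x * y' - y * x' = 0) : a * b' - b * a' = 0 := by
  obtain ⟨μ, ea, eb⟩ : ∃ μ, a = μ * (-σ * y) ∧ b = μ * x :=
    ⟨x * b - y * a, by linear_combination x * hY - a * h, by linear_combination y * hY - b * h⟩
  obtain ⟨μ', ea', eb'⟩ : ∃ μ', a' = μ' * (-σ * y') ∧ b' = μ' * x' :=
    ⟨x' * b' - y' * a', by linear_combination x' * hY' - a' * h',
      by linear_combination y' * hY' - b' * h'⟩
  rw [ea, eb, ea', eb']
  linear_combination σ * μ * μ' * hd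

/-- Two tangent vectors with common ratio, and not in the tangent spaces of both points, give a
configuration. -/
theorem IsConfiguration.of_isAdapted (H₁ : IsConvexAt ψ₁ u₁) (H₂ : IsConvexAt ψ₂ u₂)
    (ht : Transversal ψ₁ ψ₂ u₁ u₂) (h0 : lam ≠ 0) (h1 : lam ≠ 1) {w₁ w₂ : Par n}
    (hw₁ : IsAdapted ψ₁ u₁ (midChord (ψ₁ u₁) (ψ₂ u₂)) (X - midPt (ψ₁ u₁) (ψ₂ u₂)) lam
      (tangentDir ψ₁ u₁ ⊓ tangentDir ψ₂ u₂) w₁)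
    (hw₂ : IsAdapted ψ₂ u₂ (-midChord (ψ₁ u₁) (ψ₂ u₂)) (X - midPt (ψ₁ u₁) (ψ₂ u₂)) lam
      (tangentDir ψ₁ u₁ ⊓ tangentDir ψ₂ u₂) w₂) (hn₁ : w₁ ≠ 0) (hn₂ : w₂ ≠ 0) :
    IsConfiguration ψ₁ ψ₂ u₁ u₂ X lam where
  transversal := ht
  ne_zero := h0
  ne_one := h1
  left := ⟨w₁, hw₁⟩
  right := ⟨w₂, hw₂⟩
  left_ne_zero := fun hα => by
    -- If `ν₁(C) = 0`, then `ν₁(V) = 0` and the second adapted vector lies in `Z`, to which it is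
    -- orthogonal; definiteness forbids this.
    have h2 := congrArg (conormal ψ₁ u₁) hw₁.tangent
    rw [conormal_tangent, conormal_sub, conormal_smul, hα] at h2
    refine H₂.metric_ne_zero hn₂ (hw₂.orthogonal w₂ ⟨H₁.mem_tangentDir_iff.2 ?_, ⟨_, rfl⟩⟩)
    rw [hw₂.tangent, conormal_sub, conormal_smul, conormal_neg, hα]
    linarith
  right_ne_zero := fun hβ => by
    have h2 := congrArg (conormal ψ₂ u₂) hw₂.tangent
    rw [conormal_tangent, conormal_sub, conormal_smul, conormal_neg, hβ] at h2
    refine H₁.metric_ne_zero hn₁ (hw₁.orthogonal w₁ ⟨⟨_, rfl⟩, H₂.mem_tangentDir_iff.2 ?_⟩)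
    rw [hw₁.tangent, conormal_sub, conormal_smul, hβ]
    linarith

/-- The conic `{X + a v + b w | a² + σ b² = 1}`. -/
def centralConic (σ : ℝ) (X v w : Aff n) : Set (Aff n) :=
  {q | ∃ a b : ℝ, a ^ 2 + σ * b ^ 2 = 1 ∧ q = X + a • v + b • w}

theorem isEllipse_iff {K : Set (Aff n)} : IsEllipse K X ↔
    ∃ v w : Aff n, LinearIndependent ℝ ![v, w] ∧ K = centralConic 1 X v w := by
  simp only [IsEllipse, centralConic, one_mul]

theorem isHyperbola_iff {K : Set (Aff n)} : IsHyperbola K X ↔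
    ∃ v w : Aff n, LinearIndependent ℝ ![v, w] ∧ K = centralConic (-1) X v w := by
  simp only [IsHyperbola, centralConic, neg_one_mul, ← sub_eq_add_neg]

/-- The tangent direction of a contact conic, rescaled, is adapted. -/
theorem exists_isAdapted {ψ : Par n → Aff n} {u a : Par n} (H : IsConvexAt ψ u) {v w C V : Aff n}
    {σ x y a₁ b₁ a₂ b₂ c₁ c₂ v₁ v₂ P R : ℝ}
    {γ : ℝ → Aff n} (hγ1 : deriv γ 0 = a₁ • v + b₁ • w)
    (hγ2 : deriv (deriv γ) 0 = a₂ • v + b₂ • w)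
    (hx : x = c₁ - v₁) (hy : y = c₂ - v₂) (h1 : x * a₁ + σ * (y * b₁) = 0)
    (h2 : a₁ ^ 2 + σ * b₁ ^ 2 + (x * a₂ + σ * (y * b₂)) = 0) (ha : a ≠ 0)
    (hγa : deriv γ 0 = fderiv ℝ ψ u a)
    (hν : conormal ψ u (deriv (deriv γ) 0) = blaschkeMetric ψ u a a)
    (hC : C = c₁ • v + c₂ • w) (hV : V = v₁ • v + v₂ • w)
    (hP : P = v₁ ^ 2 + σ * v₂ ^ 2) (hR : R = c₁ ^ 2 + σ * c₂ ^ 2) (hPR : P + R = 1)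
    (hB : c₁ * v₁ + σ * (c₂ * v₂) = 0) (hR0 : R ≠ 0) {Z : Submodule ℝ (Aff n)}
    (hZ : OrthogonalTo ψ u a Z) : ∃ w, IsAdapted ψ u C V (-P / R) Z w := by
  have hY : a₁ ≠ 0 ∨ b₁ ≠ 0 := by
    by_contra! hab
    rw [hab.1, hab.2, zero_smul, zero_smul, add_zero, hγa] at hγ1
    exact ha (H.immersion (by rw [hγ1, map_zero]))
  subst hx hy
  obtain ⟨κ, t, k1, k2, k3, k4⟩ := conic_curvature hP hR hPR hB hR0 hY h1 h2
  have hcomb : κ ^ 2 • deriv (deriv γ) 0 =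
      (-P / R * (1 - -P / R)) • C + t • deriv γ 0 := by
    rw [hγ1, hγ2, hC, smul_add, smul_smul, smul_smul, k3, k4]
    module
  refine ⟨κ • a, ?_, ?_, fun b hb => ?_⟩
  · rw [map_smul, ← hγa, hγ1, smul_add, smul_smul, smul_smul, k1, k2, hC, hV]
    module
  · have := congrArg (conormal ψ u) hcomb
    rw [conormal_smul, hν, conormal_add, conormal_smul, conormal_smul, hγa, conormal_tangent] at this
    rw [blaschkeMetric_smul_smul]
    linarith
  · have := blaschkeMetric_smul_smul ψ u a b κ 1
    rw [one_smul] at this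
    rw [this, hZ b hb, mul_zero]

/-- A contact conic yields a configuration; its type is determined by the sign of the ratio. -/
theorem exists_isConfiguration_of_contact (H₁ : IsConvexAt ψ₁ u₁) (H₂ : IsConvexAt ψ₂ u₂)
    (ht : Transversal ψ₁ ψ₂ u₁ u₂) {σ : ℝ} (hσ : σ ≠ 0) {v w : Aff n}
    (h : LinearIndependent ℝ ![v, w]) {a₁ a₂ : Par n}
    (hc₁ : MakesContact 3 (centralConic σ X v w) ψ₁ u₁ a₁)
    (hc₂ : MakesContact 3 (centralConic σ X v w) ψ₂ u₂ a₂)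
    (ho₁ : OrthogonalTo ψ₁ u₁ a₁ (tangentDir ψ₁ u₁ ⊓ tangentDir ψ₂ u₂))
    (ho₂ : OrthogonalTo ψ₂ u₂ a₂ (tangentDir ψ₁ u₁ ⊓ tangentDir ψ₂ u₂)) :
    ∃ lam, IsConfiguration ψ₁ ψ₂ u₁ u₂ X lam ∧ σ * lam < 0 := by
  obtain ⟨ha₁, γ, hγs, hγK, hγ0, hγ1, hγ2⟩ := (makesContact_three_iff H₁).1 hc₁
  obtain ⟨ha₂, δ, hδs, hδK, hδ0, hδ1, hδ2⟩ := (makesContact_three_iff H₂).1 hc₂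
  obtain ⟨x, y, p₁, q₁, p₂, q₂, e0, e1, e2, k0, k1, k2⟩ := jet_of_conic h hγs hγK
  obtain ⟨x', y', p₁', q₁', p₂', q₂', e0', e1', e2', k0', k1', k2'⟩ := jet_of_conic h hδs hδK
  have hψ₁ : ψ₁ u₁ = X + x • v + y • w := by rw [← hγ0, e0]
  have hψ₂ : ψ₂ u₂ = X + x' • v + y' • w := by rw [← hδ0, e0']
  -- Points on a common diameter would have parallel conic tangents, so the second contact direction
  -- would lie in `Z` while being orthogonal to it.
  have hd : x * y' - y * x' ≠ 0 := by
    intro hd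
    have hpar := conic_parallel k0 k0' k1 k1' hd
    refine H₂.metric_ne_zero ha₂ (ho₂ a₂ ⟨?_, ⟨_, rfl⟩⟩)
    have hs : ∃ s : ℝ, p₁' = s * p₁ ∧ q₁' = s * q₁ := by
      by_cases hp : p₁ = 0
      · have hq : q₁ ≠ 0 := by
          rintro rfl
          rw [hp, zero_smul, zero_smul, add_zero, hγ1] at e1
          exact ha₁ (H₁.immersion (by rw [e1, map_zero]))
        refine ⟨q₁' / q₁, ?_, by field_simp⟩
        rw [hp] at hpar ⊢
        have : q₁ * p₁' = 0 := by linarith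
        simpa [hq] using this
      · refine ⟨p₁' / p₁, by field_simp, ?_⟩
        field_simp
        linarith
    obtain ⟨s, hs1, hs2⟩ := hs
    refine ⟨s • a₁, ?_⟩
    change fderiv ℝ ψ₁ u₁ (s • a₁) = fderiv ℝ ψ₂ u₂ a₂
    rw [map_smul, ← hγ1, ← hδ1, e1, e1', hs1, hs2]
    module
  have hC : midChord (ψ₁ u₁) (ψ₂ u₂) = ((x - x') / 2) • v + ((y - y') / 2) • w := by
    rw [midChord, hψ₁, hψ₂]; module
  have hC' : -midChord (ψ₁ u₁) (ψ₂ u₂) = (-(x - x') / 2) • v + (-(y - y') / 2) • w := by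
    rw [hC]; module
  have hV : X - midPt (ψ₁ u₁) (ψ₂ u₂) = (-(x + x') / 2) • v + (-(y + y') / 2) • w := by
    rw [midPt, hψ₁, hψ₂]; module
  obtain ⟨P, hP⟩ : ∃ P, P = (-(x + x') / 2) ^ 2 + σ * (-(y + y') / 2) ^ 2 := ⟨_, rfl⟩
  obtain ⟨R, hR⟩ : ∃ R, R = ((x - x') / 2) ^ 2 + σ * ((y - y') / 2) ^ 2 := ⟨_, rfl⟩
  have hPR : P + R = 1 := by rw [hP, hR]; linear_combination k0 / 2 + k0' / 2
  have hB : ((x - x') / 2) * (-(x + x') / 2) + σ * (((y - y') / 2) * (-(y + y') / 2)) = 0 := by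
    linear_combination -k0 / 4 + k0' / 4
  have hprod : P * R = σ * ((x * y' - y * x') / 2) ^ 2 := by
    rw [hP, hR]
    linear_combination (((x - x') / 2) * (-(x + x') / 2) +
      σ * (((y - y') / 2) * (-(y + y') / 2))) * hB
  have hprod0 : P * R ≠ 0 := by
    rw [hprod]
    exact mul_ne_zero hσ (pow_ne_zero _ (div_ne_zero hd two_ne_zero))
  have hP0 : P ≠ 0 := left_ne_zero_of_mul hprod0
  have hR0 : R ≠ 0 := right_ne_zero_of_mul hprod0
  obtain ⟨w₁, hw₁⟩ := exists_isAdapted H₁ e1 e2 (by ring) (by ring) k1 k2 ha₁ hγ1 hγ2 hC hV hP hR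
    hPR hB hR0 ho₁
  obtain ⟨w₂, hw₂⟩ := exists_isAdapted H₂ e1' e2' (by ring) (by ring) k1' k2' ha₂ hδ1 hδ2 hC' hV hP
    (by rw [hR]; ring) hPR (by linear_combination -hB) hR0 ho₂
  have hne : ∀ {s : ℝ}, X - midPt (ψ₁ u₁) (ψ₂ u₂) - s • midChord (ψ₁ u₁) (ψ₂ u₂) ≠ 0 := by
    intro s hs
    rw [hV, hC] at hs
    have h3 := LinearIndependent.pair_iff.1 h (-(x + x') / 2 - s * ((x - x') / 2))
      (-(y + y') / 2 - s * ((y - y') / 2)) (by rw [← hs]; module)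
    exact hd (by linear_combination ((y - y')) * h3.1 - (x - x') * h3.2)
  refine ⟨-P / R, IsConfiguration.of_isAdapted H₁ H₂ ht (div_ne_zero (neg_ne_zero.2 hP0) hR0) ?_
    hw₁ hw₂ ?_ ?_, ?_⟩
  · intro hl
    rw [div_eq_one_iff_eq hR0] at hl
    linarith
  · rintro rfl
    have := hw₁.tangent
    rw [map_zero] at this
    exact hne this.symm
  · rintro rfl
    have := hw₂.tangent
    rw [map_zero, smul_neg, ← neg_smul] at this
    exact hne this.symm
  -- Since `P R = σ d²`, with `d` up to sign the determinant of `C`, `V`, the product `σ lam` is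
  -- minus a nonzero square.
  · have h1 : σ * (-P / R) = -(σ * (P * R) / R ^ 2) := by field_simp
    have h2 : σ * (P * R) / R ^ 2 = (σ * ((x * y' - y * x') / 2) / R) ^ 2 := by
      rw [hprod]; ring
    rw [h1, h2, neg_lt_zero]
    exact lt_of_le_of_ne (sq_nonneg _) (pow_ne_zero 2 (div_ne_zero (mul_ne_zero hσ
      (div_ne_zero hd two_ne_zero)) hR0)).symm

/-! ## From a configuration to a contact conic -/

/-- A conic through `ψ u = M + C` that contains the curve `M + t V + z(t) C`, where
`z² = 1 - lam + lam (t - 1)²`, has contact of order three. -/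
theorem makesContact_of_isAdapted {K : Set (Aff n)} {ψ : Par n → Aff n} {u w : Par n}
    {M C V : Aff n} {Z : Submodule ℝ (Aff n)} (H : IsConvexAt ψ u)
    (hw : IsAdapted ψ u C V lam Z w) (hw0 : w ≠ 0) (hψ : ψ u = M + C)
    (hK : ∀ t z : ℝ, z ^ 2 = 1 - lam + lam * (t - 1) ^ 2 → M + t • V + z • C ∈ K) :
    MakesContact 3 K ψ u w := by
  set g : ℝ → ℝ := fun t => 1 - lam + lam * (t - 1) ^ 2 with hg
  have hg0 : g 0 = 1 := by simp [hg]
  have hgs : ContDiff ℝ ∞ g := by fun_prop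
  have hgd : ∀ t, HasDerivAt g (lam * (2 * (t - 1))) t := fun t =>
    ((((((hasDerivAt_id t).sub_const 1).fun_pow 2).const_mul lam).const_add
      (1 - lam))).congr_deriv (by simp)
  set z : ℝ → ℝ := fun t => √(g t) with hz
  have hz0 : z 0 = 1 := by simp [hz, hg0]
  have hzs : ContDiffAt ℝ ∞ z 0 := hgs.contDiffAt.sqrt (by rw [hg0]; exact one_ne_zero)
  have hpos : ∀ᶠ t in 𝓝 0, 0 < g t :=
    hgs.continuous.continuousAt.eventually_const_lt (by rw [hg0]; exact one_pos)
  have hzd : ∀ᶠ t in 𝓝 0, HasDerivAt z (lam * (t - 1) / z t) t := by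
    filter_upwards [hpos] with t ht
    have := (hgd t).sqrt ht.ne'
    rwa [show lam * (2 * (t - 1)) / (2 * √(g t)) = lam * (t - 1) / z t by
      rw [hz, show lam * (2 * (t - 1)) = 2 * (lam * (t - 1)) by ring,
        mul_div_mul_left _ _ two_ne_zero]] at this
  -- With `z(0) = 1` and `z'(0) = -lam`, the quotient rule gives `lam - lam²`, precisely the
  -- coefficient in the length of an adapted vector.
  have hz2 : HasDerivAt (fun t => lam * (t - 1) / z t) (lam * (1 - lam)) 0 := by
    have h1 : HasDerivAt (fun t : ℝ => lam * (t - 1)) lam 0 := by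
      simpa using ((hasDerivAt_id (0 : ℝ)).sub_const 1).const_mul lam
    refine (h1.fun_div hzd.self_of_nhds (by rw [hz0]; exact one_ne_zero)).congr_deriv ?_
    rw [hz0]
    ring
  have hγd : ∀ᶠ t in 𝓝 0, deriv (fun t => M + t • V + z t • C) t =
      V + (lam * (t - 1) / z t) • C := by
    filter_upwards [hzd] with t ht
    simpa using ((((hasDerivAt_id t).smul_const V).const_add M).fun_add (ht.smul_const C)).deriv
  refine (makesContact_three_iff H).2 ⟨hw0, fun t => M + t • V + z t • C, ?_, ?_, ?_, ?_, ?_⟩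
  · exact (contDiffAt_const.add (contDiffAt_id.smul contDiffAt_const)).add
      (hzs.smul contDiffAt_const)
  · filter_upwards [hpos] with t ht using hK t (z t) (Real.sq_sqrt ht.le)
  · simp [hz0, hψ]
  · rw [hγd.self_of_nhds, hz0, hw.tangent]
    module
  · rw [EventuallyEq.deriv_eq hγd, ((hz2.smul_const C).const_add V).deriv, conormal_smul,
      hw.length]

theorem linearIndependent_smul_smul {v w : Aff n} (h : LinearIndependent ℝ ![v, w]) {s r : ℝ}
    (hs : s ≠ 0) (hr : r ≠ 0) : LinearIndependent ℝ ![s • v, r • w] := by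
  rw [LinearIndependent.pair_iff] at h ⊢
  intro a b hab
  have := h (a * s) (b * r) (by rw [← hab]; module)
  exact ⟨by simpa [hs] using this.1, by simpa [hr] using this.2⟩

/-- The conic `{X + x V + z C | z² - lam x² = 1 - lam}`. -/
theorem exists_isConic {V C : Aff n} (h : LinearIndependent ℝ ![V, C]) (h0 : lam ≠ 0)
    (h1 : lam ≠ 1) : ∃ K, IsConic K X ∧
      ∀ x z : ℝ, z ^ 2 = 1 - lam + lam * x ^ 2 → X + x • V + z • C ∈ K := by
  have h' : LinearIndependent ℝ ![C, V] := LinearIndependent.pair_symm_iff.1 h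
  have key : ∀ {σ s r : ℝ} {v w : Aff n}, s ≠ 0 → r ≠ 0 → ∀ x z : ℝ,
      (x / s) ^ 2 + σ * (z / r) ^ 2 = 1 →
      X + x • v + z • w ∈ centralConic σ X (s • v) (r • w) := by
    intro σ s r v w hs hr x z hxz
    refine ⟨x / s, z / r, hxz, ?_⟩
    rw [smul_smul, smul_smul, div_mul_cancel₀ _ hs, div_mul_cancel₀ _ hr]
  -- After division by `1 - lam`, the equation is an ellipse for `lam < 0`, a hyperbola with real
  -- axis along `C` for `0 < lam < 1`, and one with real axis along `V` for `lam > 1`.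
  rcases lt_or_gt_of_ne h0 with hneg | hpos
  · have p1 : 0 < (1 - lam) / -lam := div_pos (by linarith) (by linarith)
    have p2 : 0 < 1 - lam := by linarith
    refine ⟨centralConic 1 X (√((1 - lam) / -lam) • V) (√(1 - lam) • C), Or.inl
      (isEllipse_iff.2 ⟨_, _, linearIndependent_smul_smul h (Real.sqrt_pos.2 p1).ne'
        (Real.sqrt_pos.2 p2).ne', rfl⟩), fun x z hxz => ?_⟩
    refine key (Real.sqrt_pos.2 p1).ne' (Real.sqrt_pos.2 p2).ne' x z ?_
    rw [div_pow, div_pow, Real.sq_sqrt p1.le, Real.sq_sqrt p2.le, hxz]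
    field_simp
    ring
  · rcases lt_or_gt_of_ne h1 with hlt | hgt
    · have p1 : 0 < (1 - lam) / lam := div_pos (by linarith) (by linarith)
      have p2 : 0 < 1 - lam := by linarith
      refine ⟨centralConic (-1) X (√(1 - lam) • C) (√((1 - lam) / lam) • V), Or.inr
        (isHyperbola_iff.2 ⟨_, _, linearIndependent_smul_smul h' (Real.sqrt_pos.2 p2).ne'
          (Real.sqrt_pos.2 p1).ne', rfl⟩), fun x z hxz => ?_⟩
      rw [add_right_comm]
      refine key (Real.sqrt_pos.2 p2).ne' (Real.sqrt_pos.2 p1).ne' z x ?_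
      rw [div_pow, div_pow, Real.sq_sqrt p1.le, Real.sq_sqrt p2.le, hxz]
      field_simp
      ring
    · have p1 : 0 < (lam - 1) / lam := div_pos (by linarith) (by linarith)
      have p2 : 0 < lam - 1 := by linarith
      refine ⟨centralConic (-1) X (√((lam - 1) / lam) • V) (√(lam - 1) • C), Or.inr
        (isHyperbola_iff.2 ⟨_, _, linearIndependent_smul_smul h (Real.sqrt_pos.2 p1).ne'
          (Real.sqrt_pos.2 p2).ne', rfl⟩), fun x z hxz => ?_⟩
      refine key (Real.sqrt_pos.2 p1).ne' (Real.sqrt_pos.2 p2).ne' x z ?_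
      rw [div_pow, div_pow, Real.sq_sqrt p1.le, Real.sq_sqrt p2.le, hxz]
      field_simp
      ring

/-- After cancelling `ν₁(C)` and `ν₂(C)`, the equations are `s lam + t = 0` and `-s lam + t = 0`.
Thus `V` and `C` are independent, even modulo `Z`. -/
theorem IsConfiguration.eq_zero_of_combination (h : IsConfiguration ψ₁ ψ₂ u₁ u₂ X lam) {s t : ℝ}
    (hst : conormal ψ₁ u₁ (s • (X - midPt (ψ₁ u₁) (ψ₂ u₂)) + t • midChord (ψ₁ u₁) (ψ₂ u₂)) = 0)
    (hst' : conormal ψ₂ u₂ (s • (X - midPt (ψ₁ u₁) (ψ₂ u₂)) + t • midChord (ψ₁ u₁) (ψ₂ u₂)) = 0) :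
    s = 0 ∧ t = 0 := by
  rw [conormal_add, conormal_smul, conormal_smul, h.conormal_left, ← mul_assoc, ← add_mul,
    mul_eq_zero, or_iff_left h.left_ne_zero] at hst
  rw [conormal_add, conormal_smul, conormal_smul, h.conormal_right, ← mul_assoc, ← add_mul,
    mul_eq_zero, or_iff_left h.right_ne_zero] at hst'
  have h2 : s * lam = 0 := by linarith
  have hs : s = 0 := (mul_eq_zero.1 h2).resolve_right h.ne_zero
  exact ⟨hs, by rw [hs] at hst; linarith⟩

theorem IsConfiguration.linearIndependent (h : IsConfiguration ψ₁ ψ₂ u₁ u₂ X lam) :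
    LinearIndependent ℝ ![X - midPt (ψ₁ u₁) (ψ₂ u₂), midChord (ψ₁ u₁) (ψ₂ u₂)] := by
  rw [LinearIndependent.pair_iff]
  intro s t hst
  exact h.eq_zero_of_combination (by rw [hst, conormal_zero]) (by rw [hst, conormal_zero])

theorem IsAdapted.ne_zero {ψ : Par n → Aff n} {u w : Par n} {C V : Aff n}
    {Z : Submodule ℝ (Aff n)} (hw : IsAdapted ψ u C V lam Z w) (h0 : lam ≠ 0) (h1 : lam ≠ 1)
    (hC : conormal ψ u C ≠ 0) : w ≠ 0 := by
  rintro rfl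
  have := hw.length
  rw [blaschkeMetric_eq, map_zero, conormal_zero] at this
  exact mul_ne_zero (mul_ne_zero h0 (sub_ne_zero.2 h1.symm)) hC this.symm

/-- The conic `z² - lam x² = 1 - lam` is invariant under `z ↦ -z`, which exchanges the two points,
so the one-point contact statement serves both, with `-C` at the second. -/
theorem IsConfiguration.exists_contactConic (h : IsConfiguration ψ₁ ψ₂ u₁ u₂ X lam)
    (H₁ : IsConvexAt ψ₁ u₁) (H₂ : IsConvexAt ψ₂ u₂) :
    ∃ K, IsConic K X ∧ ∃ a₁ a₂, MakesContact 3 K ψ₁ u₁ a₁ ∧ MakesContact 3 K ψ₂ u₂ a₂ ∧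
      OrthogonalTo ψ₁ u₁ a₁ (tangentDir ψ₁ u₁ ⊓ tangentDir ψ₂ u₂) ∧
      OrthogonalTo ψ₂ u₂ a₂ (tangentDir ψ₁ u₁ ⊓ tangentDir ψ₂ u₂) := by
  obtain ⟨w₁, hw₁⟩ := h.left
  obtain ⟨w₂, hw₂⟩ := h.right
  obtain ⟨K, hK, hmem⟩ := exists_isConic (X := X) h.linearIndependent h.ne_zero h.ne_one
  refine ⟨K, hK, w₁, w₂, ?_, ?_, hw₁.orthogonal, hw₂.orthogonal⟩
  · refine makesContact_of_isAdapted (M := midPt (ψ₁ u₁) (ψ₂ u₂)) H₁ hw₁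
      (hw₁.ne_zero h.ne_zero h.ne_one h.left_ne_zero) (by rw [midPt, midChord]; module)
      fun t z htz => ?_
    -- The curve is written from `M` and the conic from `X = M + V`, hence the shift by `1`.
    convert! hmem (t - 1) z htz using 1
    module
  · refine makesContact_of_isAdapted (M := midPt (ψ₁ u₁) (ψ₂ u₂)) H₂ hw₂
      (hw₂.ne_zero h.ne_zero h.ne_one (by rw [conormal_neg]; exact neg_ne_zero.2 h.right_ne_zero))
      (by rw [midPt, midChord]; module) fun t z htz => ?_
    convert! hmem (t - 1) (-z) (by rw [neg_sq, htz]) using 1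
    module

/-! ## Graphs in affine coordinates -/

/-- The polynomial `m x + (k / 2) x² + ∑ Aᵢⱼ yᵢ yⱼ`. -/
def graphPoly (m k : ℝ) (A : Matrix (Fin n) (Fin n) ℝ) (q : ℝ × (Fin n → ℝ)) : ℝ :=
  m * q.1 + k / 2 * q.1 ^ 2 + ∑ i, ∑ j, A i j * q.2 i * q.2 j

/-- In the linear coordinates `L`, the 2-jet of `ψ` at `u` is that of the graph of
`m x + (k / 2) x² + ∑ Aᵢⱼ yᵢ yⱼ`. -/
def HasGraphJet (ψ : Par n → Aff n) (u : Par n) (L : Aff n ≃ₗ[ℝ] Coord n) (m k : ℝ)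
    (A : Matrix (Fin n) (Fin n) ℝ) : Prop :=
  ∀ h, (L (fderiv ℝ ψ u h)).2.2 - m * (L (fderiv ℝ ψ u h)).1 = 0 ∧
    (1 / 2) * ((L (fderiv ℝ (fderiv ℝ ψ) u h h)).2.2 -
      m * (L (fderiv ℝ (fderiv ℝ ψ) u h h)).1) = k / 2 * (L (fderiv ℝ ψ u h)).1 ^ 2 +
      ∑ i, ∑ j, A i j * (L (fderiv ℝ ψ u h)).2.1 i * (L (fderiv ℝ ψ u h)).2.1 j

/-- An instance of `isBigO_cube_iff` with linear form `z - m x` and the quadratic part of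
`graphPoly`. -/
theorem hasGraphJet_iff {ψ : Par n → Aff n} {u : Par n} (hψ : ContDiffAt ℝ ∞ ψ u)
    (L : Aff n ≃ₗ[ℝ] Coord n) (m k : ℝ) (A : Matrix (Fin n) (Fin n) ℝ) :
    HasGraphJet ψ u L m k A ↔
      (fun s => (L (ψ s - ψ u)).2.2 -
        graphPoly m k A ((L (ψ s - ψ u)).1, (L (ψ s - ψ u)).2.1)) =O[𝓝 u] fun s => ‖s - u‖ ^ 3 := by
  set X : Aff n →L[ℝ] ℝ := LinearMap.toContinuousLinearMap
    ((LinearMap.fst ℝ ℝ ((Fin n → ℝ) × ℝ)).comp L.toLinearMap) with hX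
  set Z : Aff n →L[ℝ] ℝ := LinearMap.toContinuousLinearMap ((LinearMap.snd ℝ (Fin n → ℝ) ℝ).comp
    ((LinearMap.snd ℝ ℝ ((Fin n → ℝ) × ℝ)).comp L.toLinearMap)) with hZ
  set Y : Fin n → Aff n →L[ℝ] ℝ := fun i => LinearMap.toContinuousLinearMap
    ((LinearMap.proj i).comp ((LinearMap.fst ℝ (Fin n → ℝ) ℝ).comp
    ((LinearMap.snd ℝ ℝ ((Fin n → ℝ) × ℝ)).comp L.toLinearMap))) with hY
  have eX : ∀ v, X v = (L v).1 := fun v => rfl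
  have eZ : ∀ v, Z v = (L v).2.2 := fun v => rfl
  have eY : ∀ i v, Y i v = (L v).2.1 i := fun i v => rfl
  have key := isBigO_cube_iff hψ (Z - m • X)
    ((k / 2) • X.smulRight X + ∑ i, ∑ j, A i j • (Y i).smulRight (Y j))
  simp only [sub_apply, add_apply, smul_apply, sum_apply,
    ContinuousLinearMap.smulRight_apply, smul_eq_mul, eX, eZ, eY] at key
  rw [HasGraphJet]
  have e1 : ∀ v : Aff n, (k / 2) * ((L v).1 * (L v).1) +
      ∑ i, ∑ j, A i j * ((L v).2.1 i * (L v).2.1 j) =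
      k / 2 * (L v).1 ^ 2 + ∑ i, ∑ j, A i j * (L v).2.1 i * (L v).2.1 j := by
    intro v
    simp only [pow_two, mul_assoc]
  simp only [e1] at key
  rw [← key]
  refine isBigO_congr (Eventually.of_forall fun s => ?_) EventuallyEq.rfl
  simp only [graphPoly]
  ring

/-! ### Passing between patches and local graphs. -/

theorem Patch.continuousAt {S : Set (Aff n)} (P : Patch S) {u : Par n} (hu : u ∈ P.dom) :
    ContinuousAt P.ψ u := (P.smooth.contDiffAt (P.isOpen_dom.mem_nhds hu)).continuousAt

theorem Patch.mem {S : Set (Aff n)} (P : Patch S) {u : Par n} (hu : u ∈ P.dom) : P.ψ u ∈ S := by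
  obtain ⟨V, -, hV⟩ := P.image_open
  have : P.ψ u ∈ P.ψ '' P.dom := ⟨u, hu, rfl⟩
  rw [hV] at this
  exact this.1

theorem affineEquiv_apply (Φ : Aff n ≃ᵃ[ℝ] Coord n) (q p : Aff n) :
    Φ q = Φ.linear (q - p) + Φ p := by
  have := Φ.map_vadd p (q - p)
  simpa using this

/-- The jet of a patch of a graph. -/
theorem hasGraphJet_of_isLocalGraph {S : Set (Aff n)} (P : Patch S) {u : Par n} (hu : u ∈ P.dom)
    {Φ : Aff n ≃ᵃ[ℝ] Coord n} {s : ℝ} (hΦ : Φ (P.ψ u) = (0, 0, s)) {f : ℝ × (Fin n → ℝ) → ℝ}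
    (hf : IsLocalGraph S (P.ψ u) Φ f) {m k : ℝ} {A : Matrix (Fin n) (Fin n) ℝ}
    (hO : (fun q => f q - (s + graphPoly m k A q)) =O[𝓝 0] fun q => ‖q‖ ^ 3) :
    HasGraphJet P.ψ u Φ.linear m k A := by
  have hψ : ContDiffAt ℝ ∞ P.ψ u := P.smooth.contDiffAt (P.isOpen_dom.mem_nhds hu)
  rw [hasGraphJet_iff hψ]
  set L := Φ.linear
  obtain ⟨W, hW, hpW, O, hOo, h0O, -, himg⟩ := hf
  have hL : Continuous L := L.toLinearMap.continuous_of_finiteDimensional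
  have hq0 : ContinuousAt (fun t => ((L (P.ψ t - P.ψ u)).1, (L (P.ψ t - P.ψ u)).2.1)) u := by
    have : ContinuousAt (fun t => L (P.ψ t - P.ψ u)) u :=
      hL.continuousAt.comp (hψ.continuousAt.sub continuousAt_const)
    exact this.fst.prodMk this.snd.fst
  have hq : Tendsto (fun t => ((L (P.ψ t - P.ψ u)).1, (L (P.ψ t - P.ψ u)).2.1)) (𝓝 u) (𝓝 0) := by
    have e0 : ((L (P.ψ u - P.ψ u)).1, (L (P.ψ u - P.ψ u)).2.1) = (0 : ℝ × (Fin n → ℝ)) := by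
      simp
    exact e0 ▸ hq0.tendsto
  have h1 := hO.comp_tendsto hq
  have h2 : (fun t => ((L (P.ψ t - P.ψ u)).1, (L (P.ψ t - P.ψ u)).2.1)) =O[𝓝 u]
      fun t => ‖t - u‖ := by
    have h3 : (fun t => L (P.ψ t - P.ψ u)) =O[𝓝 u] fun t => ‖t - u‖ :=
      ((L.toLinearMap.toContinuousLinearMap.isBigO_comp _ _).trans
        (hψ.differentiableAt (by simp)).isBigO_sub).norm_right
    refine IsBigO.trans (IsBigO.of_bound 1 (Eventually.of_forall fun t => ?_)) h3
    rw [one_mul]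
    exact max_le (norm_fst_le (L (P.ψ t - P.ψ u)))
      ((norm_fst_le (L (P.ψ t - P.ψ u)).2).trans (norm_snd_le (L (P.ψ t - P.ψ u))))
  refine (h1.trans ((h2.norm_left.pow 3))).congr' ?_ EventuallyEq.rfl
  filter_upwards [P.isOpen_dom.mem_nhds hu, (P.continuousAt hu).preimage_mem_nhds
    (hW.mem_nhds hpW)] with t ht htW
  have hmem : Φ (P.ψ t) ∈ Φ '' (S ∩ W) := ⟨_, ⟨P.mem ht, htW⟩, rfl⟩
  rw [himg, affineEquiv_apply Φ (P.ψ t) (P.ψ u), hΦ] at hmem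
  have h3 := hmem.2
  simp only [Prod.fst_add, Prod.snd_add, add_zero] at h3
  simp only [Function.comp_apply]
  rw [← h3]
  simp only [L]
  ring

/-- An open subset of the parameter domain parametrizes a relatively open part of `S`. -/
theorem Patch.exists_image_eq {S : Set (Aff n)} (P : Patch S) {N : Set (Par n)} (hN : IsOpen N)
    (hNd : N ⊆ P.dom) : ∃ W : Set (Aff n), IsOpen W ∧ P.ψ '' N = S ∩ W := by
  obtain ⟨V, hV, himg⟩ := P.image_open
  obtain ⟨W, hW, hpre⟩ := P.embedding.isInducing.isOpen_iff.1 (hN.preimage continuous_subtype_val)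
  refine ⟨V ∩ W, hV.inter hW, ?_⟩
  have hiff : ∀ s (hs : s ∈ P.dom), P.ψ s ∈ W ↔ s ∈ N := fun s hs => by
    have : (⟨s, hs⟩ : P.dom) ∈ P.dom.domRestrict P.ψ ⁻¹' W ↔
        (⟨s, hs⟩ : P.dom) ∈ Subtype.val ⁻¹' N := by rw [hpre]
    exact this
  rw [← Set.inter_assoc, ← himg]
  ext q
  constructor
  · rintro ⟨s, hs, rfl⟩
    exact ⟨⟨s, hNd hs, rfl⟩, (hiff s (hNd hs)).2 hs⟩
  · rintro ⟨⟨s, hs, rfl⟩, hq⟩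
    exact ⟨s, (hiff s hs).1 hq, rfl⟩

/-- A smooth map with invertible derivative restricts to a diffeomorphism of open sets. -/
theorem exists_openPartialHomeomorph {E F : Type*} [NormedAddCommGroup E] [NormedSpace ℝ E]
    [CompleteSpace E] [NormedAddCommGroup F] [NormedSpace ℝ F] {φ : E → F} {D : Set E}
    (hD : IsOpen D) (hφ : ContDiffOn ℝ ∞ φ D) {u : E} (hu : u ∈ D) {e : E ≃L[ℝ] F}
    (he : HasFDerivAt φ (e : E →L[ℝ] F) u) :
    ∃ Θ : OpenPartialHomeomorph E F, (Θ : E → F) = φ ∧ u ∈ Θ.source ∧ Θ.source ⊆ D ∧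
      ContDiffOn ℝ ∞ Θ.symm Θ.target := by
  have hat : ∀ s ∈ D, ContDiffAt ℝ ∞ φ s := fun s hs => hφ.contDiffAt (hD.mem_nhds hs)
  have hcont : ContinuousAt (fderiv ℝ φ) u :=
    ((hat u hu).fderiv_right (m := ∞) (by simp)).continuousAt
  -- Invertibility is open; shrinking to where it holds makes the inverse smooth on the whole
  -- target, not only at one point.
  have hinv : ∀ᶠ s in 𝓝 u, fderiv ℝ φ s ∈ Set.range ((↑) : (E ≃L[ℝ] F) → E →L[ℝ] F) :=
    hcont.eventually_mem (by rw [he.fderiv]; exact e.nhds)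
  obtain ⟨N, hN, hNo, huN⟩ := eventually_nhds_iff.1 (hinv.and (hD.mem_nhds hu))
  set Θ₀ := (hat u hu).toOpenPartialHomeomorph φ he (by simp)
  refine ⟨Θ₀.restrOpen N hNo, rfl, ?_, ?_, ?_⟩
  · rw [OpenPartialHomeomorph.restrOpen_source]
    exact ⟨(hat u hu).mem_toOpenPartialHomeomorph_source he (by simp), huN⟩
  · rw [OpenPartialHomeomorph.restrOpen_source]
    exact fun s hs => (hN s hs.2).2
  · intro q hq
    set Θ := Θ₀.restrOpen N hNo with hΘ
    have hs : Θ.symm q ∈ Θ.source := Θ.map_target hq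
    rw [hΘ, OpenPartialHomeomorph.restrOpen_source] at hs
    obtain ⟨⟨e', he'⟩, hsD⟩ := hN _ hs.2
    refine (Θ.contDiffAt_symm (f₀' := e') hq ?_ (hat _ hsD)).contDiffWithinAt
    rw [he']
    exact ((hat _ hsD).differentiableAt (by simp)).hasFDerivAt

/-- A patch with a given 2-jet is a graph with this 2-jet. -/
theorem exists_isLocalGraph {S : Set (Aff n)} (P : Patch S) {u : Par n} (hu : u ∈ P.dom)
    {Φ : Aff n ≃ᵃ[ℝ] Coord n} {s : ℝ} (hΦ : Φ (P.ψ u) = (0, 0, s)) {m k : ℝ}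
    {A : Matrix (Fin n) (Fin n) ℝ} (hj : HasGraphJet P.ψ u Φ.linear m k A) :
    ∃ f, IsLocalGraph S (P.ψ u) Φ f ∧
      (fun q => f q - (s + graphPoly m k A q)) =O[𝓝 0] fun q => ‖q‖ ^ 3 := by
  have hψ : ContDiffAt ℝ ∞ P.ψ u := P.smooth.contDiffAt (P.isOpen_dom.mem_nhds hu)
  set L := Φ.linear with hL
  set ρ : Aff n →L[ℝ] ℝ × (Fin n → ℝ) := LinearMap.toContinuousLinearMap
    (((LinearMap.fst ℝ ℝ ((Fin n → ℝ) × ℝ)).prod ((LinearMap.fst ℝ (Fin n → ℝ) ℝ).comp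
      (LinearMap.snd ℝ ℝ ((Fin n → ℝ) × ℝ)))).comp L.toLinearMap) with hρ
  have eρ : ∀ v, ρ v = ((L v).1, (L v).2.1) := fun v => rfl
  set ζ : Aff n →L[ℝ] ℝ := LinearMap.toContinuousLinearMap ((LinearMap.snd ℝ (Fin n → ℝ) ℝ).comp
    ((LinearMap.snd ℝ ℝ ((Fin n → ℝ) × ℝ)).comp L.toLinearMap)) with hζ
  have eζ : ∀ v, ζ v = (L v).2.2 := fun v => rfl
  have hΦt : ∀ t, Φ (P.ψ t) = ((ρ (P.ψ t - P.ψ u)).1, (ρ (P.ψ t - P.ψ u)).2,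
      s + ζ (P.ψ t - P.ψ u)) := by
    intro t
    rw [affineEquiv_apply Φ (P.ψ t) (P.ψ u), hΦ, ← hL]
    ext <;> simp [eρ, eζ, add_comm]
  set φ : Par n → ℝ × (Fin n → ℝ) := fun t => ρ (P.ψ t - P.ψ u) with hφ
  have hφs : ContDiffOn ℝ ∞ φ P.dom :=
    ρ.contDiff.comp_contDiffOn (P.smooth.sub contDiffOn_const)
  have hφd : HasFDerivAt φ (ρ.comp (fderiv ℝ P.ψ u)) u :=
    ρ.hasFDerivAt.comp u ((hψ.differentiableAt (by simp)).hasFDerivAt.sub_const _)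
  -- The jet gives `z = m x` on the tangent space, so a tangent vector is determined by its `(x, y)`
  -- part.
  have hinj : Function.Injective (ρ.comp (fderiv ℝ P.ψ u)).toLinearMap := by
    rw [injective_iff_map_eq_zero]
    intro h hh
    have hh' : ρ (fderiv ℝ P.ψ u h) = 0 := hh
    rw [eρ, Prod.mk_eq_zero] at hh'
    have hz := (hj h).1
    rw [hh'.1, mul_zero, sub_zero] at hz
    refine P.immersion u hu (L.injective ?_)
    rw [map_zero, map_zero]
    exact Prod.ext hh'.1 (Prod.ext hh'.2 hz)
  obtain ⟨Θ, hΘ, huΘ, hΘd, hΘs⟩ := exists_openPartialHomeomorph P.isOpen_dom hφs hu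
    (e := (LinearMap.linearEquivOfInjective _ hinj
      (by simp [add_comm])).toContinuousLinearEquiv) (by exact hφd)
  obtain ⟨W, hW, hWimg⟩ := P.exists_image_eq Θ.open_source hΘd
  have hφu : φ u = 0 := by simp [hφ]
  have h0 : (0 : ℝ × (Fin n → ℝ)) ∈ Θ.target := by
    rw [← hφu, ← hΘ]
    exact Θ.map_source huΘ
  have hsymm0 : Θ.symm 0 = u := by
    rw [← hφu, ← hΘ]
    exact Θ.left_inv huΘ
  have hsymmAt : ContDiffAt ℝ ∞ Θ.symm 0 := hΘs.contDiffAt (Θ.open_target.mem_nhds h0)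
  refine ⟨fun q => s + ζ (P.ψ (Θ.symm q) - P.ψ u), ⟨W, hW, ?_, Θ.target, Θ.open_target, h0, ?_, ?_⟩,
    ?_⟩
  · have : P.ψ u ∈ P.ψ '' Θ.source := ⟨u, huΘ, rfl⟩
    rw [hWimg] at this
    exact this.2
  · refine contDiffOn_const.add (ζ.contDiff.comp_contDiffOn ((P.smooth.comp hΘs ?_).sub
      contDiffOn_const))
    exact fun q hq => hΘd (Θ.map_target hq)
  · rw [← hWimg]
    ext q
    constructor
    · rintro ⟨_, ⟨t, ht, rfl⟩, rfl⟩
      rw [hΦt]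
      have h1 : φ t ∈ Θ.target := by rw [← hΘ]; exact Θ.map_source ht
      have h2 : Θ.symm (φ t) = t := by rw [← hΘ]; exact Θ.left_inv ht
      refine ⟨h1, ?_⟩
      change s + ζ (P.ψ t - P.ψ u) = s + ζ (P.ψ (Θ.symm (φ t)) - P.ψ u)
      rw [h2]
    · rintro ⟨h1, h2⟩
      refine ⟨_, ⟨_, Θ.map_target h1, rfl⟩, ?_⟩
      have h3 : φ (Θ.symm (q.1, q.2.1)) = (q.1, q.2.1) := by
        rw [← hΘ]; exact Θ.right_inv h1
      rw [hΦt]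
      change ((φ (Θ.symm (q.1, q.2.1))).1, (φ (Θ.symm (q.1, q.2.1))).2, _) = q
      rw [h3]
      exact Prod.ext rfl (Prod.ext rfl h2.symm)
  · have hG := (hasGraphJet_iff hψ L m k A).1 hj
    have ht : Tendsto Θ.symm (𝓝 0) (𝓝 u) := by
      have := hsymmAt.continuousAt.tendsto
      rwa [hsymm0] at this
    have hd : (fun q => Θ.symm q - u) =O[𝓝 0] fun q => q := by
      have := (hsymmAt.differentiableAt (by simp)).isBigO_sub
      rw [hsymm0] at this
      simpa using this
    refine ((hG.comp_tendsto ht).trans (hd.norm_norm.pow 3)).congr' ?_ EventuallyEq.rfl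
    filter_upwards [Θ.open_target.mem_nhds h0] with q hq
    have h3 : φ (Θ.symm q) = q := by rw [← hΘ]; exact Θ.right_inv hq
    simp only [Function.comp_apply, ← eρ, ← eζ]
    change ζ _ - graphPoly m k A (φ (Θ.symm q)) = _
    rw [h3]
    ring

/-! ## Normal forms and configurations -/

theorem blaschkeMetric_add_add (ψ : Par n → Aff n) (u a b : Par n) :
    blaschkeMetric ψ u (a + b) (a + b) = blaschkeMetric ψ u a a + blaschkeMetric ψ u a b +
      (blaschkeMetric ψ u b a + blaschkeMetric ψ u b b) := by
  simp only [blaschkeMetric_eq, map_add, add_apply, conormal_add]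
  ring

/-! ### The 2-jet of the normal form at one point; `σ = 1` at `p₁`, `σ = -1` at `p₂`. -/

section OneSide

variable {ψ : Par n → Aff n} {u : Par n} {L : Aff n ≃ₗ[ℝ] Coord n} {σ ε p : ℝ} {C V : Aff n}
  {Z : Submodule ℝ (Aff n)}

/-- The 2-jet of the normal form yields an adapted vector. -/
theorem HasGraphJet.exists_isAdapted {A : Matrix (Fin n) (Fin n) ℝ} (H : IsConvexAt ψ u)
    (hj : HasGraphJet ψ u L (σ * (ε * p)) (-(σ * (p ^ 2 + ε))) A) (hσ : σ ^ 2 = 1)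
    (hε : ε ^ 2 = 1) (hC : L C = (0, 0, σ)) (hV : L V = (p, 0, 0))
    (hZ : ∀ v ∈ Z, (L v).1 = 0) :
    conormal ψ u C ≠ 0 ∧ ∃ w, IsAdapted ψ u C V (-(ε * p ^ 2)) Z w := by
  have hσ0 : σ ≠ 0 := by rintro rfl; norm_num at hσ
  have hα : conormal ψ u C ≠ 0 := fun h0 => by
    obtain ⟨h, hh⟩ := H.exists_fderiv_eq h0
    have := (hj h).1
    rw [hh, hC] at this
    simp [hσ0] at this
  set α := conormal ψ u C with hα'
  -- Subtracting a multiple of the chord makes `v` tangent; the slope in the jet then determines the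
  -- conormal up to its value on `C`.
  have hν : ∀ v, conormal ψ u v = σ * α * ((L v).2.2 - σ * (ε * p) * (L v).1) := by
    intro v
    obtain ⟨h, hh⟩ := H.exists_fderiv_eq (v := v - (conormal ψ u v / α) • C) (by
      rw [conormal_sub, conormal_smul, ← hα']; field_simp; ring)
    have := (hj h).1
    rw [hh, map_sub, map_smul, hC] at this
    simp only [Prod.snd_sub, Prod.smul_snd, Prod.fst_sub, Prod.smul_fst, smul_eq_mul, mul_zero,
      sub_zero] at this
    have h2 : (L v).2.2 - σ * (ε * p) * (L v).1 = conormal ψ u v / α * σ := by linarith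
    rw [h2]
    field_simp
    rw [hσ, mul_one]
  have hm : ∀ a, blaschkeMetric ψ u a a = 2 * σ * α *
      (-(σ * (p ^ 2 + ε)) / 2 * (L (fderiv ℝ ψ u a)).1 ^ 2 +
      ∑ i, ∑ j, A i j * (L (fderiv ℝ ψ u a)).2.1 i * (L (fderiv ℝ ψ u a)).2.1 j) := by
    intro a
    rw [blaschkeMetric_eq, hν, ← (hj a).2]
    ring
  obtain ⟨w, hw⟩ := H.exists_fderiv_eq (v := V - (-(ε * p ^ 2)) • C) (by
    rw [hν, map_sub, map_smul, hC, hV]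
    simp only [Prod.snd_sub, Prod.smul_snd, Prod.fst_sub, Prod.smul_fst, smul_eq_mul]
    ring)
  have hLw : L (fderiv ℝ ψ u w) = (p, 0, σ * (ε * p ^ 2)) := by
    rw [hw, map_sub, map_smul, hC, hV]
    ext <;> simp [mul_comm]
  have hww : blaschkeMetric ψ u w w = -(ε * p ^ 2) * (1 - -(ε * p ^ 2)) * α := by
    rw [hm, hLw]
    simp only [Pi.zero_apply, mul_zero, Finset.sum_const_zero, add_zero]
    linear_combination -α * (p ^ 2 + ε) * p ^ 2 * hσ + α * p ^ 4 * hε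
  refine ⟨hα, w, hw, hww, fun b hb => ?_⟩
  -- Polarization: `w` has no `y` part, vectors of `Z` have no `x` part, and the jet has no mixed
  -- terms.
  have h1 := blaschkeMetric_add_add ψ u w b
  rw [H.metric_symm b w, hm (w + b), hm w, hm b, map_add, map_add, hLw] at h1
  simp only [Prod.fst_add, Prod.snd_add, Pi.add_apply, Pi.zero_apply, zero_add, mul_zero,
    Finset.sum_const_zero, add_zero, hZ _ hb] at h1
  linarith

/-- An adapted vector yields the 2-jet of the normal form. -/
theorem IsAdapted.exists_hasGraphJet (H : IsConvexAt ψ u) {w : Par n}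
    (hw : IsAdapted ψ u C V (-(ε * p ^ 2)) Z w) (hp : p ≠ 0) (hσ : σ ^ 2 = 1)
    (hε : ε ^ 2 = 1) (hC : L C = (0, 0, σ)) (hV : L V = (p, 0, 0)) (hα : conormal ψ u C ≠ 0)
    (hZ : ∀ v, v ∈ Z ↔ (L v).1 = 0 ∧ (L v).2.2 = 0) (hZt : Z ≤ tangentDir ψ u) :
    ∃ A, IsDefinite A ∧ HasGraphJet ψ u L (σ * (ε * p)) (-(σ * (p ^ 2 + ε))) A := by
  have hσ0 : σ ≠ 0 := by rintro rfl; norm_num at hσ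
  set α := conormal ψ u C with hα'
  have hνV : conormal ψ u V = -(ε * p ^ 2) * α := by
    have := congrArg (conormal ψ u) hw.tangent
    rw [conormal_tangent, conormal_sub, conormal_smul] at this
    linarith
  have hν : ∀ v, conormal ψ u v = σ * α * ((L v).2.2 - σ * (ε * p) * (L v).1) := by
    intro v
    -- Modulo `Z` every vector is a combination of `V` and `C`, on which the conormal is known.
    have h1 : v - ((L v).1 / p) • V - (σ * (L v).2.2) • C ∈ Z := by
      rw [hZ, map_sub, map_sub, map_smul, map_smul, hC, hV]
      constructor
      · simp [hp]
      · simp only [Prod.snd_sub, Prod.smul_snd, smul_eq_mul]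
        linear_combination -(L v).2.2 * hσ
    have h2 := H.mem_tangentDir_iff.1 (hZt h1)
    rw [conormal_sub, conormal_sub, conormal_smul, conormal_smul, hνV, ← hα'] at h2
    have h3 : (L v).1 / p * (-(ε * p ^ 2) * α) = -(ε * p * α * (L v).1) := by field_simp
    rw [h3] at h2
    linear_combination h2 - (ε * p * α * (L v).1) * (-hσ)
  have he : ∀ j : Fin n, ∃ e, fderiv ℝ ψ u e = L.symm (0, Pi.single j 1, 0) := fun j =>
    hZt ((hZ _).2 (by simp))
  choose e he using he
  set E : (Fin n → ℝ) → Par n := fun y => ∑ j, y j • e j with hE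
  have hLE : ∀ y, L (fderiv ℝ ψ u (E y)) = (0, y, 0) := by
    intro y
    simp only [hE, map_sum, map_smul, he, LinearEquiv.apply_symm_apply]
    refine Prod.ext ?_ (Prod.ext ?_ ?_)
    · simp [Prod.fst_sum]
    · ext i
      simp [Prod.fst_sum, Prod.snd_sum, Pi.single_apply]
    · simp [Prod.snd_sum]
  have hEZ : ∀ y, fderiv ℝ ψ u (E y) ∈ Z := fun y => (hZ _).2 (by rw [hLE]; exact ⟨rfl, rfl⟩)
  have hEE : ∀ y, blaschkeMetric ψ u (E y) (E y) =
      ∑ i, ∑ j, blaschkeMetric ψ u (e i) (e j) * y i * y j := by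
    intro y
    have hsum : ∀ (s : Finset (Fin n)) (f : Fin n → Aff n),
        conormal ψ u (∑ i ∈ s, f i) = ∑ i ∈ s, conormal ψ u (f i) := fun s f =>
      map_sum (conormalCLM ψ u) f s
    simp only [blaschkeMetric_eq, hE, map_sum, map_smul, sum_apply, smul_apply, hsum,
      conormal_smul]
    rw [Finset.sum_comm]
    simp only [mul_comm, Finset.mul_sum]
  have hE0 : ∀ y, y ≠ 0 → E y ≠ 0 := by
    intro y hy h0
    have := hLE y
    rw [h0, map_zero, map_zero] at this
    exact hy (congrArg (fun q : Coord n => q.2.1) this).symm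
  have hσα : 2 * (σ * α) ≠ 0 := mul_ne_zero two_ne_zero (mul_ne_zero hσ0 hα)
  -- The Hessian of the graph along `Z`: the metric there, with the factor `2 σ α` relating `h` to
  -- the quadratic part of the graph removed.
  set A : Matrix (Fin n) (Fin n) ℝ :=
    Matrix.of fun i j => blaschkeMetric ψ u (e i) (e j) / (2 * (σ * α)) with hA
  have hQ : ∀ y, ∑ i, ∑ j, A i j * y i * y j =
      blaschkeMetric ψ u (E y) (E y) / (2 * (σ * α)) := by
    intro y
    rw [hEE]
    simp only [hA, Matrix.of_apply, Finset.sum_div]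
    exact Finset.sum_congr rfl fun i _ => Finset.sum_congr rfl fun j _ => by ring
  have hdot : ∀ (B : Matrix (Fin n) (Fin n) ℝ) (y : Fin n → ℝ),
      star y ⬝ᵥ B.mulVec y = ∑ i, ∑ j, B i j * y i * y j := by
    intro B y
    simp only [dotProduct, Matrix.mulVec, star_trivial, Finset.mul_sum]
    exact Finset.sum_congr rfl fun i _ => Finset.sum_congr rfl fun j _ => by ring
  have hherm : A.IsHermitian := by
    ext i j
    simp [hA, H.metric_symm (e i) (e j)]
  have hpos : (∀ y : Fin n → ℝ, y ≠ 0 → 0 < ∑ i, ∑ j, A i j * y i * y j) → IsDefinite A := fun h =>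
    Or.inl (Matrix.PosDef.of_dotProduct_mulVec_pos hherm fun y hy => by rw [hdot]; exact h y hy)
  have hneg : (∀ y : Fin n → ℝ, y ≠ 0 → ∑ i, ∑ j, A i j * y i * y j < 0) → IsDefinite A := fun h =>
    Or.inr (Matrix.PosDef.of_dotProduct_mulVec_pos hherm.neg fun y hy => by
      rw [hdot]
      simpa using h y hy)
  refine ⟨A, ?_, fun h => ⟨?_, ?_⟩⟩
  · simp only [hQ] at hpos hneg
    rcases H.definite with hd | hd <;> rcases lt_or_gt_of_ne hσα with hs | hs
    · exact hneg fun y hy => div_neg_of_pos_of_neg (hd _ (hE0 y hy)) hs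
    · exact hpos fun y hy => div_pos (hd _ (hE0 y hy)) hs
    · exact hpos fun y hy => div_pos_of_neg_of_neg (hd _ (hE0 y hy)) hs
    · exact hneg fun y hy => div_neg_of_neg_of_pos (hd _ (hE0 y hy)) hs
  · have := hν (fderiv ℝ ψ u h)
    rw [conormal_tangent, eq_comm, mul_eq_zero, or_iff_right (mul_ne_zero hσ0 hα)] at this
    exact this
  · have h0 := hν (fderiv ℝ ψ u h)
    rw [conormal_tangent, eq_comm, mul_eq_zero, or_iff_right (mul_ne_zero hσ0 hα)] at h0
    have hLw : L (fderiv ℝ ψ u w) = (p, 0, σ * (ε * p ^ 2)) := by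
      rw [hw.tangent, map_sub, map_smul, hC, hV]
      ext <;> simp [mul_comm]
    have hdec : h = ((L (fderiv ℝ ψ u h)).1 / p) • w + E (L (fderiv ℝ ψ u h)).2.1 := by
      refine H.immersion (L.injective ?_)
      rw [map_add, map_add, hLE, map_smul, map_smul, hLw]
      refine Prod.ext ?_ (Prod.ext ?_ ?_)
      · simp [hp]
      · simp
      · simp only [Prod.snd_add, Prod.smul_snd, smul_eq_mul, add_zero]
        field_simp
        linear_combination h0
    have hmet : blaschkeMetric ψ u h h = (L (fderiv ℝ ψ u h)).1 ^ 2 / p ^ 2 *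
        blaschkeMetric ψ u w w + blaschkeMetric ψ u (E (L (fderiv ℝ ψ u h)).2.1)
          (E (L (fderiv ℝ ψ u h)).2.1) := by
      conv_lhs => rw [hdec]
      have h1 := blaschkeMetric_smul_smul ψ u w (E (L (fderiv ℝ ψ u h)).2.1)
        ((L (fderiv ℝ ψ u h)).1 / p) 1
      rw [one_smul, hw.orthogonal _ (hEZ _), mul_zero] at h1
      rw [blaschkeMetric_add_add, H.metric_symm (E _) (_ • w), h1, blaschkeMetric_smul_smul]
      ring
    have h2 := hν (fderiv ℝ (fderiv ℝ ψ) u h h)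
    rw [← blaschkeMetric_eq, hmet, hw.length, ← hα'] at h2
    rw [hQ]
    set B := blaschkeMetric ψ u (E (L (fderiv ℝ ψ u h)).2.1) (E (L (fderiv ℝ ψ u h)).2.1)
    set ℓ := (L (fderiv ℝ (fderiv ℝ ψ) u h h)).2.2 -
      σ * (ε * p) * (L (fderiv ℝ (fderiv ℝ ψ) u h h)).1
    set x := (L (fderiv ℝ ψ u h)).1
    -- The `x²` coefficient: `lam (1 - lam) / p² = -(p² + ε)` for `lam = -ε p²`, by `ε² = 1`.
    have h3 : x ^ 2 / p ^ 2 * (-(ε * p ^ 2) * (1 - -(ε * p ^ 2)) * α) =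
        -(p ^ 2 + ε) * x ^ 2 * α := by
      field_simp
      linear_combination -x ^ 2 * p ^ 2 * hε
    rw [h3] at h2
    have h4 : B = σ * α * ℓ + (p ^ 2 + ε) * x ^ 2 * α := by linarith
    rw [h4]
    field_simp
    linear_combination x ^ 2 * (p ^ 2 + ε) * hσ

end OneSide

/-! ### The two points together in affine coordinates. -/

variable {S₁ S₂ : Set (Aff n)} {p₁ p₂ X : Aff n} {Φ : Aff n ≃ᵃ[ℝ] Coord n} {ε p lam : ℝ}

theorem linear_midChord (Φ : Aff n ≃ᵃ[ℝ] Coord n) (h₁ : Φ p₁ = (0, 0, 1))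
    (h₂ : Φ p₂ = (0, 0, -1)) : Φ.linear (midChord p₁ p₂) = (0, 0, 1) := by
  have h := affineEquiv_apply Φ p₁ p₂
  rw [h₁, h₂, ← sub_eq_iff_eq_add] at h
  rw [midChord, map_smul, ← h]
  ext <;> norm_num

theorem linear_sub_midPt (Φ : Aff n ≃ᵃ[ℝ] Coord n) (h₁ : Φ p₁ = (0, 0, 1))
    (h₂ : Φ p₂ = (0, 0, -1)) (hX : Φ X = (p, 0, 0)) :
    Φ.linear (X - midPt p₁ p₂) = (p, 0, 0) := by
  have k₁ := affineEquiv_apply Φ X p₁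
  have k₂ := affineEquiv_apply Φ X p₂
  rw [h₁, hX, ← sub_eq_iff_eq_add] at k₁
  rw [h₂, hX, ← sub_eq_iff_eq_add] at k₂
  have : X - midPt p₁ p₂ = (1 / 2 : ℝ) • ((X - p₁) + (X - p₂)) := by rw [midPt]; module
  rw [this, map_smul, map_add, ← k₁, ← k₂]
  ext <;> simp
  ring

/-- The cubic bound holds at the origin itself, where it forces `f 0 = s`. This puts the base points
of a normal form on the hypersurfaces. -/
theorem IsLocalGraph.mem {S : Set (Aff n)} {q : Aff n} {f : ℝ × (Fin n → ℝ) → ℝ} {s m k : ℝ}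
    {A : Matrix (Fin n) (Fin n) ℝ} (hf : IsLocalGraph S q Φ f) (hq : Φ q = (0, 0, s))
    (hO : (fun r => f r - (s + graphPoly m k A r)) =O[𝓝 0] fun r => ‖r‖ ^ 3) : q ∈ S := by
  obtain ⟨c, hc⟩ := hO.bound
  have h0 := hc.self_of_nhds
  simp only [graphPoly, norm_zero, Prod.fst_zero, Prod.snd_zero, Pi.zero_apply, mul_zero,
    Finset.sum_const_zero, add_zero, ne_eq, OfNat.ofNat_ne_zero, not_false_eq_true, zero_pow,
    norm_le_zero_iff, sub_eq_zero] at h0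
  obtain ⟨W, -, -, O, -, hO0, -, himg⟩ := hf
  have : Φ q ∈ Φ '' (S ∩ W) := by
    rw [himg, hq]
    exact ⟨hO0, h0.symm⟩
  obtain ⟨r, hr, hrq⟩ := this
  rw [← Φ.injective hrq]
  exact hr.1

/-- The two expansions of the normal form, in a uniform shape. -/
theorem isNormalForm_iff : IsNormalForm S₁ S₂ p₁ p₂ Φ ε p ↔
    (ε = 1 ∨ ε = -1) ∧ ε * p < 0 ∧ Φ p₁ = (0, 0, 1) ∧ Φ p₂ = (0, 0, -1) ∧
    (∃ f A, IsDefinite A ∧ IsLocalGraph S₁ p₁ Φ f ∧ (fun q => f q - (1 +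
      graphPoly (1 * (ε * p)) (-(1 * (p ^ 2 + ε))) A q)) =O[𝓝 0] fun q => ‖q‖ ^ 3) ∧
    ∃ f A, IsDefinite A ∧ IsLocalGraph S₂ p₂ Φ f ∧ (fun q => f q - (-1 +
      graphPoly (-1 * (ε * p)) (-(-1 * (p ^ 2 + ε))) A q)) =O[𝓝 0] fun q => ‖q‖ ^ 3 := by
  have e1 : ∀ (f : ℝ × (Fin n → ℝ) → ℝ) (A : Matrix (Fin n) (Fin n) ℝ),
      (fun q => f q - (1 + ε * p * q.1 - (1 / 2) * (p ^ 2 + ε) * q.1 ^ 2 +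
        ∑ i, ∑ j, A i j * q.2 i * q.2 j)) =
      fun q => f q - (1 + graphPoly (1 * (ε * p)) (-(1 * (p ^ 2 + ε))) A q) := by
    intro f A
    funext q
    rw [graphPoly]
    ring
  have e2 : ∀ (f : ℝ × (Fin n → ℝ) → ℝ) (A : Matrix (Fin n) (Fin n) ℝ),
      (fun q => f q - (-1 - ε * p * q.1 + (1 / 2) * (p ^ 2 + ε) * q.1 ^ 2 +
        ∑ i, ∑ j, A i j * q.2 i * q.2 j)) =
      fun q => f q - (-1 + graphPoly (-1 * (ε * p)) (-(-1 * (p ^ 2 + ε))) A q) := by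
    intro f A
    funext q
    rw [graphPoly]
    ring
  simp only [IsNormalForm, e1, e2]
  constructor
  · rintro ⟨h1, h2, h3, h4, f₁, f₂, A, B, g₁, g₂, hA, hB, o₁, o₂⟩
    exact ⟨h1, h2, h3, h4, ⟨f₁, A, hA, g₁, o₁⟩, ⟨f₂, B, hB, g₂, o₂⟩⟩
  · rintro ⟨h1, h2, h3, h4, ⟨f₁, A, hA, g₁, o₁⟩, ⟨f₂, B, hB, g₂, o₂⟩⟩
    exact ⟨h1, h2, h3, h4, f₁, f₂, A, B, g₁, g₂, hA, hB, o₁, o₂⟩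

theorem IsNormalForm.isConfiguration (hN : IsNormalForm S₁ S₂ p₁ p₂ Φ ε p) (hX : Φ X = (p, 0, 0))
    (P₁ : Patch S₁) (P₂ : Patch S₂) {u₁ u₂ : Par n} (hu₁ : u₁ ∈ P₁.dom) (hu₂ : u₂ ∈ P₂.dom)
    (h₁ : P₁.ψ u₁ = p₁) (h₂ : P₂.ψ u₂ = p₂) (H₁ : IsConvexAt P₁.ψ u₁) (H₂ : IsConvexAt P₂.ψ u₂) :
    IsConfiguration P₁.ψ P₂.ψ u₁ u₂ X (-(ε * p ^ 2)) := by
  subst h₁ h₂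
  obtain ⟨hε, hεp, hΦ₁, hΦ₂, ⟨f, A, -, hf, hfO⟩, ⟨g, B, -, hg, hgO⟩⟩ := isNormalForm_iff.1 hN
  have hε2 : ε ^ 2 = 1 := by rcases hε with rfl | rfl <;> norm_num
  have hp : p ≠ 0 := by rintro rfl; simp at hεp
  have hε0 : ε ≠ 0 := by rintro rfl; norm_num at hε2
  have hj₁ := hasGraphJet_of_isLocalGraph P₁ hu₁ hΦ₁ hf hfO
  have hj₂ := hasGraphJet_of_isLocalGraph P₂ hu₂ hΦ₂ hg hgO
  have hC := linear_midChord Φ hΦ₁ hΦ₂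
  have hV := linear_sub_midPt Φ hΦ₁ hΦ₂ hX
  have hC' : Φ.linear (-midChord (P₁.ψ u₁) (P₂.ψ u₂)) = (0, 0, -1) := by
    rw [map_neg, hC]; simp
  -- The tangent directions satisfy `z = ε p x` and `z = -ε p x`, so `x = 0` on the intersection.
  have hZ : ∀ v ∈ tangentDir P₁.ψ u₁ ⊓ tangentDir P₂.ψ u₂, (Φ.linear v).1 = 0 := by
    rintro v ⟨⟨a, rfl⟩, ⟨b, hb⟩⟩
    have k₁ := (hj₁ a).1
    have k₂ := (hj₂ b).1
    change fderiv ℝ P₂.ψ u₂ b = fderiv ℝ P₁.ψ u₁ a at hb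
    rw [hb] at k₂
    have k₃ : 2 * (ε * p) * (Φ.linear (fderiv ℝ P₁.ψ u₁ a)).1 = 0 := by linarith
    exact (mul_eq_zero.1 k₃).resolve_left (mul_ne_zero two_ne_zero hεp.ne)
  obtain ⟨hα, w₁, hw₁⟩ := hj₁.exists_isAdapted H₁ (by norm_num) hε2 hC hV hZ
  obtain ⟨hβ, w₂, hw₂⟩ := hj₂.exists_isAdapted H₂ (by norm_num) hε2 hC' hV hZ
  have hne : ∀ {ψ : Par n → Aff n} {u w : Par n} {D : Aff n} {Z : Submodule ℝ (Aff n)},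
      (Φ.linear D).1 = 0 →
      IsAdapted ψ u D (X - midPt (P₁.ψ u₁) (P₂.ψ u₂)) (-(ε * p ^ 2)) Z w → w ≠ 0 := by
    rintro ψ u w D Z hD hw rfl
    have := congrArg (fun v => (Φ.linear v).1) hw.tangent
    simp only [map_zero, map_sub, map_smul, hV, Prod.fst_sub, Prod.smul_fst, hD, Prod.fst_zero,
      smul_zero, sub_zero] at this
    exact hp this.symm
  have hn₁ := hne (by rw [hC]) hw₁
  have hn₂ := hne (by rw [hC']) hw₂
  have hl0 : -(ε * p ^ 2) ≠ 0 := neg_ne_zero.2 (mul_ne_zero hε0 (pow_ne_zero 2 hp))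
  refine IsConfiguration.of_isAdapted H₁ H₂ ?_ hl0 ?_ hw₁ hw₂ hn₁ hn₂
  · rw [Transversal, eq_top_iff]
    rintro v -
    have k₁ := congrArg (conormal P₁.ψ u₁) hw₁.tangent
    have k₂ := congrArg (conormal P₁.ψ u₁) hw₂.tangent
    rw [conormal_tangent, conormal_sub, conormal_smul] at k₁
    rw [conormal_sub, conormal_smul, conormal_neg] at k₂
    set α := conormal P₁.ψ u₁ (midChord (P₁.ψ u₁) (P₂.ψ u₂))
    -- Transversality: `ν₁(V + lam C) = 2 lam ν₁(C)` is nonzero.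
    have k₃ : conormal P₁.ψ u₁ (fderiv ℝ P₂.ψ u₂ w₂) ≠ 0 := by
      rw [show conormal P₁.ψ u₁ (fderiv ℝ P₂.ψ u₂ w₂) = 2 * (-(ε * p ^ 2) * α) by linarith]
      exact mul_ne_zero two_ne_zero (mul_ne_zero hl0 hα)
    set t := conormal P₁.ψ u₁ v / conormal P₁.ψ u₁ (fderiv ℝ P₂.ψ u₂ w₂)
    refine Submodule.mem_sup.2 ⟨v - t • fderiv ℝ P₂.ψ u₂ w₂, ?_, t • fderiv ℝ P₂.ψ u₂ w₂,
      Submodule.smul_mem _ _ ⟨w₂, rfl⟩, sub_add_cancel _ _⟩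
    rw [H₁.mem_tangentDir_iff, conormal_sub, conormal_smul, div_mul_cancel₀ _ k₃, sub_self]
  · intro hl
    have := hw₁.length
    rw [hl, sub_self, mul_zero, zero_mul] at this
    exact H₁.metric_ne_zero hn₁ this

theorem finrank_inf_tangentDir {ψ₁ ψ₂ : Par n → Aff n} {u₁ u₂ : Par n}
    (ht : Transversal ψ₁ ψ₂ u₁ u₂) (H₁ : IsConvexAt ψ₁ u₁) (H₂ : IsConvexAt ψ₂ u₂) :
    Module.finrank ℝ ↥(tangentDir ψ₁ u₁ ⊓ tangentDir ψ₂ u₂) = n := by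
  have h := Submodule.finrank_sup_add_finrank_inf_eq (tangentDir ψ₁ u₁) (tangentDir ψ₂ u₂)
  rw [show tangentDir ψ₁ u₁ ⊔ tangentDir ψ₂ u₂ = ⊤ from ht, finrank_top] at h
  have h1 : Module.finrank ℝ (tangentDir ψ₁ u₁) = n + 1 := by
    rw [tangentDir, LinearMap.finrank_range_of_inj H₁.immersion]; simp
  have h2 : Module.finrank ℝ (tangentDir ψ₂ u₂) = n + 1 := by
    rw [tangentDir, LinearMap.finrank_range_of_inj H₂.immersion]; simp
  rw [h1, h2, Module.finrank_fin_fun] at h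
  omega

/-- Linear coordinates adapted to a configuration. -/
theorem IsConfiguration.exists_linearEquiv {ψ₁ ψ₂ : Par n → Aff n} {u₁ u₂ : Par n}
    (h : IsConfiguration ψ₁ ψ₂ u₁ u₂ X lam) (H₁ : IsConvexAt ψ₁ u₁) (H₂ : IsConvexAt ψ₂ u₂)
    (hp : p ≠ 0) : ∃ L : Aff n ≃ₗ[ℝ] Coord n, L (midChord (ψ₁ u₁) (ψ₂ u₂)) = (0, 0, 1) ∧
      L (X - midPt (ψ₁ u₁) (ψ₂ u₂)) = (p, 0, 0) ∧
      ∀ v, v ∈ tangentDir ψ₁ u₁ ⊓ tangentDir ψ₂ u₂ ↔ (L v).1 = 0 ∧ (L v).2.2 = 0 := by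
  set C := midChord (ψ₁ u₁) (ψ₂ u₂) with hC
  set V := X - midPt (ψ₁ u₁) (ψ₂ u₂) with hV
  set Z := tangentDir ψ₁ u₁ ⊓ tangentDir ψ₂ u₂ with hZ
  have hfr : Module.finrank ℝ (Fin n → ℝ) = Module.finrank ℝ Z := by
    rw [finrank_inf_tangentDir h.transversal H₁ H₂, Module.finrank_fin_fun]
  set ι : (Fin n → ℝ) ≃ₗ[ℝ] Z := LinearEquiv.ofFinrankEq _ _ hfr
  -- The inverse of the coordinates: it identifies the `y`-space with `Z` and is injective because
  -- `V` and `C` are independent modulo `Z`.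
  set T : Coord n →ₗ[ℝ] Aff n :=
    ((LinearMap.toSpanSingleton ℝ (Aff n) ((1 / p) • V)).coprod
      ((Z.subtype.comp ι.toLinearMap).coprod (LinearMap.toSpanSingleton ℝ (Aff n) C))) with hT
  have eT : ∀ q, T q = (q.1 / p) • V + ((ι q.2.1 : Aff n) + q.2.2 • C) := by
    intro q
    simp only [hT, LinearMap.coprod_apply, LinearMap.toSpanSingleton_apply, LinearMap.comp_apply,
      smul_smul, mul_one_div]
    rfl
  have hz₁ : ∀ z : Z, conormal ψ₁ u₁ z = 0 := fun z => H₁.mem_tangentDir_iff.1 z.2.1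
  have hz₂ : ∀ z : Z, conormal ψ₂ u₂ z = 0 := fun z => H₂.mem_tangentDir_iff.1 z.2.2
  have hker : ∀ q, T q ∈ Z → q.1 = 0 ∧ q.2.2 = 0 := by
    intro q hq
    have k₁ := H₁.mem_tangentDir_iff.1 hq.1
    have k₂ := H₂.mem_tangentDir_iff.1 hq.2
    rw [eT, conormal_add, conormal_add, hz₁, zero_add, ← conormal_add] at k₁
    rw [eT, conormal_add, conormal_add, hz₂, zero_add, ← conormal_add] at k₂
    obtain ⟨e1, e2⟩ := h.eq_zero_of_combination k₁ k₂
    exact ⟨by simpa [hp] using e1, e2⟩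
  have hinj : Function.Injective T := by
    rw [injective_iff_map_eq_zero]
    intro q hq
    obtain ⟨e1, e2⟩ := hker q (by rw [hq]; exact Z.zero_mem)
    rw [eT, e1, e2, zero_div, zero_smul, zero_smul, zero_add, add_zero,
      Submodule.coe_eq_zero] at hq
    exact Prod.ext e1 (Prod.ext (ι.map_eq_zero_iff.1 hq) e2)
  set Te := T.linearEquivOfInjective hinj (by simp; ring) with hTe
  have eTe : ∀ q, Te q = T q := fun q => rfl
  refine ⟨Te.symm, ?_, ?_, fun v => ⟨fun hv => ?_, fun hv => ?_⟩⟩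
  · rw [LinearEquiv.symm_apply_eq, eTe, eT]
    simp
  · rw [LinearEquiv.symm_apply_eq, eTe, eT]
    simp [hp]
  · refine hker _ ?_
    rw [← eTe, LinearEquiv.apply_symm_apply]
    exact hv
  · have : v = T (Te.symm v) := by rw [← eTe, LinearEquiv.apply_symm_apply]
    rw [this, eT, hv.1, hv.2, zero_div, zero_smul, zero_smul, zero_add, add_zero]
    exact (ι _).2

theorem IsConfiguration.exists_isNormalForm (P₁ : Patch S₁) (P₂ : Patch S₂) {u₁ u₂ : Par n}
    (hu₁ : u₁ ∈ P₁.dom) (hu₂ : u₂ ∈ P₂.dom) (H₁ : IsConvexAt P₁.ψ u₁) (H₂ : IsConvexAt P₂.ψ u₂)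
    (h : IsConfiguration P₁.ψ P₂.ψ u₁ u₂ X lam) :
    ∃ (Φ : Aff n ≃ᵃ[ℝ] Coord n) (ε p : ℝ),
      IsNormalForm S₁ S₂ (P₁.ψ u₁) (P₂.ψ u₂) Φ ε p ∧ Φ X = (p, 0, 0) := by
  -- `lam = -ε p²` fixes `ε` as the sign of `-lam` and `p` up to sign, which `ε p < 0` decides.
  obtain ⟨ε, p, hε, hεp, hlam⟩ : ∃ ε p : ℝ, (ε = 1 ∨ ε = -1) ∧ ε * p < 0 ∧
      lam = -(ε * p ^ 2) := by
    rcases lt_or_gt_of_ne h.ne_zero with hn | hn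
    · refine ⟨1, -√(-lam), Or.inl rfl, ?_, ?_⟩
      · have := Real.sqrt_pos.2 (neg_pos.2 hn)
        linarith
      · rw [neg_sq, Real.sq_sqrt (neg_pos.2 hn).le]
        ring
    · refine ⟨-1, √lam, Or.inr rfl, ?_, ?_⟩
      · have := Real.sqrt_pos.2 hn
        linarith
      · rw [Real.sq_sqrt hn.le]
        ring
  have hε2 : ε ^ 2 = 1 := by rcases hε with rfl | rfl <;> norm_num
  have hp : p ≠ 0 := by rintro rfl; simp at hεp
  subst hlam
  obtain ⟨L, hC, hV, hZ⟩ := h.exists_linearEquiv H₁ H₂ hp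
  set Φ : Aff n ≃ᵃ[ℝ] Coord n :=
    (AffineEquiv.constVAdd ℝ (Aff n) (-midPt (P₁.ψ u₁) (P₂.ψ u₂))).trans L.toAffineEquiv with hΦ
  have hlin : Φ.linear = L := LinearEquiv.ext fun v => rfl
  have eΦ : ∀ q, Φ q = L (q - midPt (P₁.ψ u₁) (P₂.ψ u₂)) := by
    intro q
    simp [hΦ, neg_add_eq_sub]
  have hC' : L (-midChord (P₁.ψ u₁) (P₂.ψ u₂)) = (0, 0, -1) := by
    rw [map_neg, hC]; simp
  have hΦ₁ : Φ (P₁.ψ u₁) = (0, 0, 1) := by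
    rw [eΦ, ← hC]
    congr 1
    rw [midPt, midChord]; module
  have hΦ₂ : Φ (P₂.ψ u₂) = (0, 0, -1) := by
    rw [eΦ, ← hC']
    congr 1
    rw [midPt, midChord]; module
  obtain ⟨w₁, hw₁⟩ := h.left
  obtain ⟨w₂, hw₂⟩ := h.right
  obtain ⟨A, hA, hj₁⟩ := hw₁.exists_hasGraphJet H₁ hp (by norm_num) hε2 hC hV h.left_ne_zero hZ
    inf_le_left
  obtain ⟨B, hB, hj₂⟩ := hw₂.exists_hasGraphJet H₂ hp (by norm_num) hε2 hC' hV
    (by rw [conormal_neg]; exact neg_ne_zero.2 h.right_ne_zero) hZ inf_le_right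
  rw [← hlin] at hj₁ hj₂
  obtain ⟨f, hf, hfO⟩ := exists_isLocalGraph P₁ hu₁ hΦ₁ hj₁
  obtain ⟨g, hg, hgO⟩ := exists_isLocalGraph P₂ hu₂ hΦ₂ hj₂
  exact ⟨Φ, ε, p, isNormalForm_iff.2 ⟨hε, hεp, hΦ₁, hΦ₂, ⟨f, A, hA, hf, hfO⟩, ⟨g, B, hB, hg, hgO⟩⟩,
    by rw [eΦ, hV]⟩

/-! ## The pairs of points -/

theorem generatesEMH_iff (hc₁ : IsLocallyConvex S₁) (hc₂ : IsLocallyConvex S₂) :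
    GeneratesEMH S₁ S₂ p₁ p₂ X ↔ ∃ P₁ : Patch S₁, ∃ P₂ : Patch S₂, ∃ u₁ ∈ P₁.dom, ∃ u₂ ∈ P₂.dom,
      P₁.ψ u₁ = p₁ ∧ P₂.ψ u₂ = p₂ ∧ ∃ lam, IsConfiguration P₁.ψ P₂.ψ u₁ u₂ X lam := by
  constructor
  · rintro ⟨P₁, P₂, u₁, hu₁, u₂, hu₂, rfl, rfl, h1, h2, h3, h4, h5⟩
    exact ⟨P₁, P₂, u₁, hu₁, u₂, hu₂, rfl, rfl, (generatesAt_iff (P₁.isConvexAt hc₁ hu₁)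
      (P₂.isConvexAt hc₂ hu₂)).1 ⟨h1, h2, h3, h4, h5⟩⟩
  · rintro ⟨P₁, P₂, u₁, hu₁, u₂, hu₂, rfl, rfl, h⟩
    have := (generatesAt_iff (P₁.isConvexAt hc₁ hu₁) (P₂.isConvexAt hc₂ hu₂)).2 h
    exact ⟨P₁, P₂, u₁, hu₁, u₂, hu₂, rfl, rfl, this.1, this.2, this.3, this.4, this.5⟩

theorem IsContactConic.exists_isConfiguration (hc₁ : IsLocallyConvex S₁) (hc₂ : IsLocallyConvex S₂)
    {σ : ℝ} (hσ : σ ≠ 0) {v w : Aff n} (hvw : LinearIndependent ℝ ![v, w])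
    (h : IsContactConic S₁ S₂ p₁ p₂ (centralConic σ X v w)) :
    ∃ P₁ : Patch S₁, ∃ P₂ : Patch S₂, ∃ u₁ ∈ P₁.dom, ∃ u₂ ∈ P₂.dom, P₁.ψ u₁ = p₁ ∧ P₂.ψ u₂ = p₂ ∧
      ∃ lam, IsConfiguration P₁.ψ P₂.ψ u₁ u₂ X lam ∧ σ * lam < 0 := by
  obtain ⟨P₁, P₂, u₁, hu₁, u₂, hu₂, a₁, a₂, h1, h2, ht, k₁, k₂, o₁, o₂⟩ := h
  exact ⟨P₁, P₂, u₁, hu₁, u₂, hu₂, h1, h2, exists_isConfiguration_of_contact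
    (P₁.isConvexAt hc₁ hu₁) (P₂.isConvexAt hc₂ hu₂) ht hσ hvw k₁ k₂ o₁ o₂⟩

theorem generatesEMH_iff_contactConic (hc₁ : IsLocallyConvex S₁) (hc₂ : IsLocallyConvex S₂) :
    GeneratesEMH S₁ S₂ p₁ p₂ X ↔ ∃ K, IsConic K X ∧ IsContactConic S₁ S₂ p₁ p₂ K := by
  rw [generatesEMH_iff hc₁ hc₂]
  constructor
  · rintro ⟨P₁, P₂, u₁, hu₁, u₂, hu₂, h1, h2, lam, h⟩
    obtain ⟨K, hK, a₁, a₂, k₁, k₂, o₁, o₂⟩ :=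
      h.exists_contactConic (P₁.isConvexAt hc₁ hu₁) (P₂.isConvexAt hc₂ hu₂)
    exact ⟨K, hK, P₁, P₂, u₁, hu₁, u₂, hu₂, a₁, a₂, h1, h2, h.transversal, k₁, k₂, o₁, o₂⟩
  · rintro ⟨K, hK, h⟩
    obtain ⟨σ, hσ, v, w, hvw, rfl⟩ : ∃ σ : ℝ, σ ≠ 0 ∧ ∃ v w : Aff n,
        LinearIndependent ℝ ![v, w] ∧ K = centralConic σ X v w := by
      rcases hK with hK | hK
      · exact ⟨1, one_ne_zero, isEllipse_iff.1 hK⟩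
      · exact ⟨-1, by norm_num, isHyperbola_iff.1 hK⟩
    obtain ⟨P₁, P₂, u₁, hu₁, u₂, hu₂, h1, h2, lam, hl, -⟩ :=
      h.exists_isConfiguration hc₁ hc₂ hσ hvw
    exact ⟨P₁, P₂, u₁, hu₁, u₂, hu₂, h1, h2, lam, hl⟩

theorem generatesEMH_iff_isNormalForm (hS₁ : IsSmoothHypersurface S₁)
    (hS₂ : IsSmoothHypersurface S₂) (hc₁ : IsLocallyConvex S₁) (hc₂ : IsLocallyConvex S₂) :
    GeneratesEMH S₁ S₂ p₁ p₂ X ↔ ∃ (Φ : Aff n ≃ᵃ[ℝ] Coord n) (ε p : ℝ),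
      IsNormalForm S₁ S₂ p₁ p₂ Φ ε p ∧ Φ X = (p, 0, 0) := by
  rw [generatesEMH_iff hc₁ hc₂]
  constructor
  · rintro ⟨P₁, P₂, u₁, hu₁, u₂, hu₂, rfl, rfl, lam, h⟩
    exact h.exists_isNormalForm P₁ P₂ hu₁ hu₂ (P₁.isConvexAt hc₁ hu₁) (P₂.isConvexAt hc₂ hu₂)
  · rintro ⟨Φ, ε, p, hN, hX⟩
    obtain ⟨-, -, hΦ₁, hΦ₂, ⟨f, A, -, hf, hfO⟩, ⟨g, B, -, hg, hgO⟩⟩ := isNormalForm_iff.1 hN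
    obtain ⟨P₁, u₁, hu₁, h1⟩ := hS₁ p₁ (hf.mem hΦ₁ hfO)
    obtain ⟨P₂, u₂, hu₂, h2⟩ := hS₂ p₂ (hg.mem hΦ₂ hgO)
    exact ⟨P₁, P₂, u₁, hu₁, u₂, hu₂, h1, h2, _, hN.isConfiguration hX P₁ P₂ hu₁ hu₂ h1 h2
      (P₁.isConvexAt hc₁ hu₁) (P₂.isConvexAt hc₂ hu₂)⟩

/-- The sign of a contact conic in a normal form. -/
theorem IsNormalForm.sign_eq (hc₁ : IsLocallyConvex S₁) (hc₂ : IsLocallyConvex S₂)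
    (hN : IsNormalForm S₁ S₂ p₁ p₂ Φ ε p) (hX : Φ X = (p, 0, 0)) {σ : ℝ} (hσ : σ = 1 ∨ σ = -1)
    {v w : Aff n} (hvw : LinearIndependent ℝ ![v, w])
    (h : IsContactConic S₁ S₂ p₁ p₂ (centralConic σ X v w)) : ε = σ := by
  obtain ⟨P₁, P₂, u₁, hu₁, u₂, hu₂, h1, h2, lam, hl, hs⟩ :=
    h.exists_isConfiguration hc₁ hc₂ (by rcases hσ with rfl | rfl <;> norm_num) hvw
  -- On the same patches the conic gives `σ lam < 0` and the normal form gives `lam = -ε p²`;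
  -- uniqueness of the ratio forces equal signs.
  have := hl.unique (hN.isConfiguration hX P₁ P₂ hu₁ hu₂ h1 h2 (P₁.isConvexAt hc₁ hu₁)
    (P₂.isConvexAt hc₂ hu₂))
  subst this
  rcases hN.1 with rfl | rfl <;> rcases hσ with rfl | rfl
  · rfl
  · nlinarith [sq_nonneg p]
  · nlinarith [sq_nonneg p]
  · rfl

end EMHConics

end

/-! ### The main theorem. -/

theorem mainTheorem2 (n : ℕ) (S₁ S₂ : Set (EMHConics.Aff n))
    (hS₁ : EMHConics.IsSmoothHypersurface S₁) (hS₂ : EMHConics.IsSmoothHypersurface S₂)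
    (hc₁ : EMHConics.IsLocallyConvex S₁) (hc₂ : EMHConics.IsLocallyConvex S₂) :
    EMHConics.contactConicCenters S₁ S₂ = EMHConics.EMH S₁ S₂ ∧
    ∀ p₁ p₂ X : EMHConics.Aff n,
      (EMHConics.GeneratesEMH S₁ S₂ p₁ p₂ X ↔
        ∃ K, EMHConics.IsConic K X ∧ EMHConics.IsContactConic S₁ S₂ p₁ p₂ K) ∧
      (EMHConics.GeneratesEMH S₁ S₂ p₁ p₂ X ↔
        ∃ (Φ : EMHConics.Aff n ≃ᵃ[ℝ] EMHConics.Coord n) (ε p : ℝ),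
          EMHConics.IsNormalForm S₁ S₂ p₁ p₂ Φ ε p ∧ Φ X = (p, 0, 0)) ∧
      ∀ (Φ : EMHConics.Aff n ≃ᵃ[ℝ] EMHConics.Coord n) (ε p : ℝ),
        EMHConics.IsNormalForm S₁ S₂ p₁ p₂ Φ ε p → Φ X = (p, 0, 0) →
        ∀ K, EMHConics.IsConic K X → EMHConics.IsContactConic S₁ S₂ p₁ p₂ K →
          (EMHConics.IsEllipse K X ↔ ε = 1) ∧ (EMHConics.IsHyperbola K X ↔ ε = -1) := by
  have hiff : ∀ p₁ p₂ X : EMHConics.Aff n, EMHConics.GeneratesEMH S₁ S₂ p₁ p₂ X ↔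
      ∃ K, EMHConics.IsConic K X ∧ EMHConics.IsContactConic S₁ S₂ p₁ p₂ K := fun p₁ p₂ X =>
    EMHConics.generatesEMH_iff_contactConic hc₁ hc₂
  refine ⟨?_, fun p₁ p₂ X => ⟨hiff p₁ p₂ X,
    EMHConics.generatesEMH_iff_isNormalForm hS₁ hS₂ hc₁ hc₂, ?_⟩⟩
  · ext X
    simp only [EMHConics.contactConicCenters, EMHConics.EMH, Set.mem_ofPred_eq, hiff]
  · intro Φ ε p hN hX K hK h
    have he : EMHConics.IsEllipse K X → ε = 1 := fun hK => by
      obtain ⟨v, w, hvw, rfl⟩ := EMHConics.isEllipse_iff.1 hK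
      exact hN.sign_eq hc₁ hc₂ hX (Or.inl rfl) hvw h
    have hh : EMHConics.IsHyperbola K X → ε = -1 := fun hK => by
      obtain ⟨v, w, hvw, rfl⟩ := EMHConics.isHyperbola_iff.1 hK
      exact hN.sign_eq hc₁ hc₂ hX (Or.inr rfl) hvw h
    -- The converses hold because a conic has one of the two types and each type fixes `ε`.
    refine ⟨⟨he, fun h1 => hK.resolve_right fun h2 => ?_⟩,
      ⟨hh, fun h1 => hK.resolve_left fun h2 => ?_⟩⟩
    · have := hh h2
      norm_num [h1] at this
    · have := he h2
      norm_num [h1] at this
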